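/- In the randomized LOCAL model, the $n$ nodes of an undirected simple graph $G=(V,E)$ are processors. Initially each node knows only $n$, $\varepsilon$, its own degree, its own weight, and a private source of randomness (independent across nodes). In each synchronous round every node performs arbitrary computation and exchanges a message of arbitrary size with each of its neighbours in $G$; at the end each node outputs whether it belongs to the cover. There are absolute constants $c\ge 1$, $C>0$ and $n_0$ such that for every $n\ge n_0$ and every $\varepsilon\in(0,1)$ (which may depend on $n$) there is a randomized LOCAL algorithm with the following property. On every $n$-node graph $G=(V,E)$ with arbitrary non-negative real node weights $w$, after at most $$C\left(\frac{\log n}{(\log\log n)^2}+\frac{\log n\cdot\log(1/\varepsilon)}{(\log\log n)^3}\right)$$ rounds the set $S$ of nodes that output "in the cover" satisfies, with probability at least $1-n^{-c}$: $S$ is a vertex cover of $G$, and $\sum_{v\in S}w(v)\le(2+\varepsilon)\sum_{v\in S'}w(v)$ for every vertex cover $S'$ of $G$. That is, $S$ is a $(2+\varepsilon)$-approximate minimum weight vertex cover with high probability. -/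

import Mathlib

open scoped NNReal

/-- A port numbering of `G`: every vertex `v` has its incident edges attached to the ports
`0, …, deg v - 1`. The bijection forces `deg v` to be the degree of `v`. -/
structure PortNumbering {V : Type} (G : SimpleGraph V) where
  /-- The number of ports of a vertex. -/
  deg : V → ℕ
  /-- The neighbour reached through a port. -/
  port : ∀ v, Fin (deg v) ≃ G.neighborSet v

/-- The private randomness of one node: an infinite sequence of numbers in `[0, 1]`. -/
abbrev Seed : Type := ℕ → unitInterval

/-- A randomized algorithm in the LOCAL model. All nodes run the same code. At the start a node
sees only its own degree, its own local input and its own random seed (in particular no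
identifiers are provided). Computation, states and messages are unrestricted. -/
structure LocalAlgorithm (In Out : Type) where
  /-- Local states. -/
  State : Type
  /-- Messages, of arbitrary size. -/
  Msg : Type
  /-- Initial state, from the degree, the local input and the random seed. -/
  init : ℕ → In → Seed → State
  /-- The message that a node of degree `d` sends through each of its `d` ports. -/
  send : (d : ℕ) → State → Fin d → Msg
  /-- The new state of a node of degree `d`, from the messages received through its ports. -/
  recv : (d : ℕ) → State → (Fin d → Msg) → State
  /-- The local output. -/
  output : State → Out

namespace LocalAlgorithm

variable {In Out V : Type} {G : SimpleGraph V}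

/-- The state of each node after `t` synchronous rounds. In one round every node sends one message
to each neighbour, and then updates its state with the messages sent to it: the message arriving
at port `i` of `v` is the one that the neighbour `u` behind this port sends through the port of
`u` that leads to `v`. -/
def stateAfter (A : LocalAlgorithm In Out) (P : PortNumbering G) (x : V → In) (s : V → Seed) :
    ℕ → V → A.State
  | 0, v => A.init (P.deg v) (x v) (s v)
  | t + 1, v =>
      A.recv (P.deg v) (A.stateAfter P x s t v) fun i =>
        A.send (P.deg (P.port v i)) (A.stateAfter P x s t (P.port v i))
          ((P.port (P.port v i)).symm ⟨v, SimpleGraph.Adj.symm (P.port v i).2⟩)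

/-- The local outputs when the algorithm is stopped after `t` rounds. -/
def outputAfter (A : LocalAlgorithm In Out) (P : PortNumbering G) (x : V → In) (s : V → Seed)
    (t : ℕ) (v : V) : Out :=
  A.output (A.stateAfter P x s t v)

end LocalAlgorithm

/-- The joint law of all private seeds: all entries of all seeds are independent and uniform on
`[0, 1]`. -/
noncomputable def seedMeasure (V : Type) [Fintype V] : MeasureTheory.Measure (V → Seed) :=
  MeasureTheory.Measure.pi fun _ : V =>
    MeasureTheory.Measure.infinitePi fun _ : ℕ =>
      (MeasureTheory.volume : MeasureTheory.Measure unitInterval)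

/-- The set of nodes that output `true`. -/
def selected {V : Type} [Fintype V] (out : V → Bool) : Finset V :=
  Finset.univ.filter fun v => out v = true

/-- `S` is a vertex cover of `G` whose weight is at most `ρ` times the weight of every vertex
cover of `G`, hence at most `ρ` times the minimum weight of a vertex cover. -/
def IsApproxMinWeightVertexCover {V : Type} (G : SimpleGraph V) (w : V → ℝ≥0) (ρ : ℝ)
    (S : Finset V) : Prop :=
  G.IsVertexCover (S : Set V) ∧
    ∀ S' : Finset V, G.IsVertexCover (S' : Set V) →
      ∑ v ∈ S, (w v : ℝ) ≤ ρ * ∑ v ∈ S', (w v : ℝ)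

/-! The cover comes from the primal-dual method. A fractional edge packing is built in which each
node loses residual weight equal to the flow on its incident edges, and the nodes with residual at
most `ε / 4` of their weight are selected. Weak duality gives the factor `2 / (1 - ε / 4) ≤ 2 + ε`
as soon as every edge has a selected endpoint (`run_covers`).

To process many edges at once, nodes are clustered at random over `s` levels, as in the construction
of sparse spanners. At level `i` a cluster survives with probability `p i`, and orphaned nodes join
a neighbouring surviving cluster if there is one. A node with none retires. With high probability a
node retiring at level `i` sees at most `4 log n / p i` clusters, and nobody reaches level `s`. Each
edge belongs to its endpoint `v` that retires first, and its other endpoint `u` then still lies in a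
cluster of that level. The edges of `v` are thus grouped into few bundles, one per adjacent cluster.

In one operation `v` offers a `ρ` fraction of its residual, split over its bundles in proportion to
`K ^ acc`, where `acc` counts the offers that a bundle has fully accepted. Each cluster routes its
offers by a maximal flow. So either the bundle of `u` accepts, or `u` loses a `ρ` fraction of its
residual (`accStep_or_saturated`). Moreover, either the potential `∑ K ^ acc` at most doubles, or
`v` loses a `ρ / K` fraction (`potential_step_or`). Losses by constant fractions can happen only
about `K log (1 / ε) / ρ` times before a node is selected. Without losses `K ^ acc` grows by `K` per
operation while the potential only doubles, which is impossible for long if `v` has few bundles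
(`run_progress`, `run_covers`).

An operation of level `i` inspects radius `3 (i + 1)`, so an epoch of radius `3 s` has room for `s /
(i + 1)` of them. The survival probabilities make `log (1 / p i)` proportional to `1 / (i + 1)`, so
that all levels need about the same number of epochs. The harmonic sum in this balancing and the
factor `log K` each save a factor `log log n`.

Everything is a function of a ball of the network, so a node can gather that ball and simulate the
process, with a random real as identifier. -/

/-- The local data of a node in a network with nodes of type `α`: its neighbours, its weight and
its random bits. -/
structure NodeRecord (α : Type) where
  nbr : List α
  wt : ℝ≥0
  bit : ℕ → Bool

/-- A network on the node type `α`. -/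
abbrev World (α : Type) : Type := α → NodeRecord α

/-! ### Clusters, bundles and the packing process on a network. -/

namespace World

variable {α : Type}

/-- The nodes reachable from `v` in at most `r` steps. -/
def ball (W : World α) : ℕ → α → Set α
  | 0, v => {v}
  | r + 1, v => {v} ∪ {x | ∃ u ∈ (W v).nbr, x ∈ ball W r u}

/-- `W` and `W'` coincide on the ball of radius `r` around `v`. -/
def Agree (W W' : World α) (r : ℕ) (v : α) : Prop :=
  ∀ u ∈ W.ball r v, W u = W' u

theorem self_mem_ball (W : World α) (r : ℕ) (v : α) : v ∈ W.ball r v := by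
  cases r <;> simp [ball]

theorem ball_trans {W : World α} {d r : ℕ} {u v x : α} (hu : u ∈ W.ball d v)
    (hx : x ∈ W.ball r u) : x ∈ W.ball (d + r) v := by
  induction d generalizing v with
  | zero =>
    obtain rfl : u = v := hu
    simpa using hx
  | succ d ih =>
    rw [Nat.succ_add]
    rcases hu with hu | ⟨y, hy, hu⟩
    · obtain rfl : u = v := hu
      clear ih
      induction r generalizing u x with
      | zero =>
        obtain rfl : x = u := hx
        exact self_mem_ball _ _ _
      | succ r ihr =>
        rcases hx with hx | ⟨y, hy, hx⟩
        · exact Or.inl hx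
        · refine Or.inr ⟨y, hy, ?_⟩
          have := ihr hx
          rwa [show d + (r + 1) = (d + r).succ from rfl]
    · exact Or.inr ⟨y, hy, ih hu⟩

theorem ball_mono {W : World α} {r r' : ℕ} (h : r ≤ r') (v : α) : W.ball r v ⊆ W.ball r' v := by
  obtain ⟨k, rfl⟩ := Nat.exists_eq_add_of_le' h
  exact fun x hx => ball_trans (self_mem_ball W k v) hx

theorem nbr_mem_ball {W : World α} {v u : α} (h : u ∈ (W v).nbr) : u ∈ W.ball 1 v :=
  Or.inr ⟨u, h, rfl⟩

theorem Agree.mono {W W' : World α} {r r' : ℕ} {v : α} (h : Agree W W' r' v) (hr : r ≤ r') :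
    Agree W W' r v := fun u hu => h u (ball_mono hr v hu)

theorem Agree.of_mem {W W' : World α} {r d R : ℕ} {v u : α} (h : Agree W W' R v)
    (hu : u ∈ W.ball d v) (hR : d + r ≤ R) : Agree W W' r u :=
  fun x hx => h x (ball_mono hR v (ball_trans hu hx))

theorem Agree.of_nbr {W W' : World α} {r R : ℕ} {v u : α} (h : Agree W W' R v)
    (hu : u ∈ (W v).nbr) (hR : 1 + r ≤ R) : Agree W W' r u :=
  h.of_mem (nbr_mem_ball hu) hR

theorem Agree.self {W W' : World α} {r : ℕ} {v : α} (h : Agree W W' r v) : W v = W' v :=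
  h v (self_mem_ball _ _ _)

theorem Agree.ball_eq {W W' : World α} {r : ℕ} {v : α} (h : Agree W W' r v) :
    W.ball r v = W'.ball r v := by
  induction r generalizing v with
  | zero => rfl
  | succ r ih =>
    ext x
    simp only [ball, Set.mem_union, Set.mem_singleton_iff, Set.mem_ofPred_eq]
    rw [← h.self]
    refine or_congr Iff.rfl (exists_congr fun u => and_congr_right fun hu => ?_)
    rw [ih (h.of_nbr hu (by omega))]

/-- The center of the level-`i` cluster of `a`, if there is one. At level `0` every node is a
cluster. A cluster survives level `i` if the bit of its center is set; a node whose cluster does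
not survive joins the surviving cluster of its first suitable neighbour. -/
def center (W : World α) : ℕ → α → Option α
  | 0, a => some a
  | i + 1, a => (center W i a).bind fun b =>
      if (W b).bit i then some b
      else ((W a).nbr.filterMap (center W i)).find? fun b => (W b).bit i

/-- `v` belongs to a cluster of level `i` but to none of level `i + 1`. -/
def Retired (W : World α) (i : ℕ) (v : α) : Prop :=
  (W.center i v).isSome ∧ W.center (i + 1) v = none

/-- Changing cluster costs one hop per level, so clusters of level `i` have radius at most `i`. -/
theorem mem_ball_of_center {W : World α} {i : ℕ} {a b : α} (h : W.center i a = some b) :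
    b ∈ W.ball i a := by
  induction i generalizing a with
  | zero =>
    simp only [center, Option.some.injEq] at h
    exact h.symm
  | succ i ih =>
    simp only [center, Option.bind_eq_some_iff] at h
    obtain ⟨c, hc, h⟩ := h
    split_ifs at h with hb
    · obtain rfl : c = b := by simpa using h
      exact ball_mono (Nat.le_succ i) a (ih hc)
    · obtain ⟨u, hu, hub⟩ := List.mem_filterMap.1 (List.mem_of_find?_eq_some h)
      exact Or.inr ⟨u, hu, ih hub⟩

theorem center_congr {W W' : World α} {i : ℕ} {a : α} (h : Agree W W' i a) :
    W.center i a = W'.center i a := by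
  induction i generalizing a with
  | zero => rfl
  | succ i ih =>
    have key : ∀ b ∈ W.ball (i + 1) a, (W b).bit i = (W' b).bit i := fun b hb => by rw [h b hb]
    have h1 : W.center i a = W'.center i a := ih (h.mono (Nat.le_succ i))
    have h2 : (W a).nbr.filterMap (W.center i) = (W' a).nbr.filterMap (W'.center i) := by
      rw [← h.self]
      exact List.filterMap_congr fun u hu => ih (h.of_nbr hu (by omega))
    simp only [center]
    rw [← h1, ← h2]
    cases hc : W.center i a with
    | none => rfl
    | some c =>
      have hc' := key c (ball_mono (Nat.le_succ i) a (mem_ball_of_center hc))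
      simp only [Option.bind_some, hc']
      congr 1
      refine List.find?_congr fun b hb => key b ?_
      obtain ⟨u, hu, hub⟩ := List.mem_filterMap.1 hb
      exact Or.inr ⟨u, hu, mem_ball_of_center hub⟩

theorem retired_congr {W W' : World α} {i : ℕ} {a : α} (h : Agree W W' (i + 1) a) :
    W.Retired i a ↔ W'.Retired i a := by
  unfold Retired
  rw [center_congr h, center_congr (h.mono (Nat.le_succ i))]

open scoped Classical in
/-- The centers of the level-`i` clusters that contain a neighbour of `v`. -/
noncomputable def bundles (W : World α) (i : ℕ) (v : α) : Finset α :=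
  ((W v).nbr.filterMap (W.center i)).toFinset

theorem mem_bundles {W : World α} {i : ℕ} {v b : α} :
    b ∈ W.bundles i v ↔ ∃ u ∈ (W v).nbr, W.center i u = some b := by
  simp [bundles]

theorem bundles_congr {W W' : World α} {i : ℕ} {a : α} (h : Agree W W' (i + 1) a) :
    W.bundles i a = W'.bundles i a := by
  unfold bundles
  rw [← h.self]
  congr 1
  exact List.filterMap_congr fun u hu => center_congr (h.of_nbr hu (by omega))

/-- The edges between the cluster with center `b` and the nodes that retire at level `i`. -/
def edgesTo (W : World α) (i : ℕ) (b : α) : Set (α × α) :=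
  {e | e.2 ∈ W.ball i b ∧ e.1 ∈ (W e.2).nbr ∧ W.Retired i e.1 ∧ W.center i e.2 = some b}

/-- Radii add up: `u` is within `i` of `b`, its neighbour `v` one step further, and retirement of
`v` inspects another `i + 1`. -/
theorem edgesTo_congr {W W' : World α} {i : ℕ} {b : α} (h : Agree W W' (2 * i + 2) b) :
    W.edgesTo i b = W'.edgesTo i b := by
  ext ⟨v, u⟩
  simp only [edgesTo, Set.mem_ofPred_eq]
  rw [← (h.mono (show i ≤ _ by omega)).ball_eq]
  refine and_congr_right fun hu => ?_
  rw [← (h.of_mem (r := 0) hu (by omega)).self]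
  refine and_congr_right fun hv => ?_
  rw [retired_congr (h.of_mem (ball_trans hu (nbr_mem_ball hv)) (by omega)),
    center_congr (h.of_mem hu (by omega))]

/-- A flow along the edges `E` with supplies `a` and capacities `κ` that cannot be increased. -/
structure IsMaximalFlow (E : Set (α × α)) (a κ : α → ℝ) (z : α → α → ℝ) : Prop where
  nonneg : ∀ v u, 0 ≤ z v u
  supp : ∀ v u, z v u ≠ 0 → (v, u) ∈ E
  out_le : ∀ e ∈ E, ∑ᶠ u, z e.1 u ≤ a e.1
  in_le : ∀ e ∈ E, ∑ᶠ v, z v e.2 ≤ κ e.2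
  maximal : ∀ e ∈ E, ∑ᶠ u, z e.1 u = a e.1 ∨ ∑ᶠ v, z v e.2 = κ e.2

open scoped Classical in
/-- A maximal flow, depending only on the values of `a` and `κ` at the endpoints of `E`. -/
noncomputable def maxFlow (E : Set (α × α)) (a κ : α → ℝ) : α → α → ℝ :=
  Classical.epsilon (IsMaximalFlow E (fun v => if v ∈ Prod.fst '' E then a v else 0)
    fun u => if u ∈ Prod.snd '' E then κ u else 0)

/-- Zeroing the data away from the endpoints of `E` makes the two predicates under `epsilon`
identical, hence also the chosen flows. This lets different nodes simulate the same flow without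
coordination. -/
theorem maxFlow_congr {E : Set (α × α)} {a a' κ κ' : α → ℝ} (ha : ∀ e ∈ E, a e.1 = a' e.1)
    (hκ : ∀ e ∈ E, κ e.2 = κ' e.2) : maxFlow E a κ = maxFlow E a' κ' := by
  unfold maxFlow
  congr 2
  · ext v
    split_ifs with h
    · obtain ⟨e, he, rfl⟩ := h
      exact ha e he
    · rfl
  · ext v
    split_ifs with h
    · obtain ⟨e, he, rfl⟩ := h
      exact hκ e he
    · rfl

/-- What `v` offers to the cluster with center `b`: a share of its residual weight `rem v`,
distributed over its bundles according to the numbers `acc v b` of earlier offers that were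
accepted completely. -/
noncomputable def offer (W : World α) (K ρ : ℝ) (i : ℕ) (rem : α → ℝ) (acc : α → α → ℕ)
    (v b : α) : ℝ :=
  ρ * rem v * (K ^ acc v b / ∑ c ∈ W.bundles i v, K ^ acc v c)

/-- How the cluster with center `b` accepts the offers of the nodes retired at level `i`. -/
noncomputable def clusterFlow (W : World α) (K ρ : ℝ) (i : ℕ) (rem : α → ℝ) (acc : α → α → ℕ)
    (b : α) : α → α → ℝ :=
  maxFlow (W.edgesTo i b) (fun v => W.offer K ρ i rem acc v b) fun u => ρ * rem u

open scoped Classical in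
/-- The update of the numbers of accepted offers. -/
noncomputable def accStep (W : World α) (K ρ : ℝ) (i : ℕ) (rem : α → ℝ) (acc : α → α → ℕ) :
    α → α → ℕ := fun v b =>
  if b ∈ W.bundles i v ∧ W.Retired i v ∧
      ∑ᶠ u, W.clusterFlow K ρ i rem acc b v u = W.offer K ρ i rem acc v b
  then acc v b + 1 else acc v b

/-- The flow from `v` to `u` in one operation of level `i`. -/
noncomputable def pairFlow (W : World α) (K ρ : ℝ) (i : ℕ) (rem : α → ℝ) (acc : α → α → ℕ)
    (v u : α) : ℝ :=
  (W.center i u).elim 0 fun b => W.clusterFlow K ρ i rem acc b v u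

open scoped Classical in
/-- The flow into and out of `v` in one operation of level `i`. -/
noncomputable def opLoad (W : World α) (K ρ : ℝ) (i : ℕ) (rem : α → ℝ) (acc : α → α → ℕ)
    (v : α) : ℝ :=
  ∑ u ∈ (W v).nbr.toFinset, (W.pairFlow K ρ i rem acc v u + W.pairFlow K ρ i rem acc u v)

/-- The numbers of accepted offers after `k` operations of level `i`. -/
noncomputable def accAfter (W : World α) (K ρ : ℝ) (i : ℕ) (rem : α → ℝ) (acc : α → α → ℕ) :
    ℕ → α → α → ℕ
  | 0 => acc
  | k + 1 => W.accStep K ρ i rem (accAfter W K ρ i rem acc k)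

/-- The residual weights and the numbers of accepted offers (per level) after `t` epochs. In each
epoch, level `i < s` performs `s / (i + 1)` operations. -/
noncomputable def run (W : World α) (s : ℕ) (K ρ : ℝ) : ℕ → (α → ℝ) × (ℕ → α → α → ℕ)
  | 0 => (fun v => (W v).wt, fun _ _ _ => 0)
  | t + 1 =>
    (fun v => (run W s K ρ t).1 v - ∑ i ∈ Finset.range s, ∑ k ∈ Finset.range (s / (i + 1)),
        W.opLoad K ρ i (run W s K ρ t).1
          (W.accAfter K ρ i (run W s K ρ t).1 ((run W s K ρ t).2 i) k) v,
      fun i => W.accAfter K ρ i (run W s K ρ t).1 ((run W s K ρ t).2 i) (s / (i + 1)))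

/-! ### How far each quantity looks into the network. -/

section Locality

variable {W W' : World α} {K ρ : ℝ} {i : ℕ} {rem rem' : α → ℝ} {acc acc' : α → α → ℕ}

theorem offer_congr {v : α} (h : Agree W W' (i + 1) v) (hr : rem v = rem' v)
    (ha : acc v = acc' v) : W.offer K ρ i rem acc v = W'.offer K ρ i rem' acc' v := by
  ext b
  unfold offer
  rw [bundles_congr h, hr, ha]

theorem clusterFlow_congr {b : α} (h : Agree W W' (2 * i + 2) b)
    (hr : ∀ x ∈ W.ball (i + 1) b, rem x = rem' x) (ha : ∀ x ∈ W.ball (i + 1) b, acc x = acc' x) :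
    W.clusterFlow K ρ i rem acc b = W'.clusterFlow K ρ i rem' acc' b := by
  unfold clusterFlow
  rw [← edgesTo_congr h]
  refine maxFlow_congr (fun e he => ?_) fun e he => ?_
  · have he1 := ball_trans he.1 (nbr_mem_ball he.2.1)
    rw [offer_congr (h.of_mem he1 (by omega)) (hr _ he1) (ha _ he1)]
  · rw [hr _ (ball_mono (Nat.le_succ i) b he.1)]

/-- An adjacent center is within `i + 1` and its flow inspects `2 * i + 2` more. For other `b` the
flow may be out of sight, but the membership test in `accStep` leaves the count unchanged. -/
theorem accStep_congr {v : α} (h : Agree W W' (3 * i + 3) v)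
    (hr : ∀ x ∈ W.ball (2 * i + 2) v, rem x = rem' x)
    (ha : ∀ x ∈ W.ball (2 * i + 2) v, acc x = acc' x) :
    W.accStep K ρ i rem acc v = W'.accStep K ρ i rem' acc' v := by
  ext b
  unfold accStep
  rw [← bundles_congr (h.mono (show i + 1 ≤ _ by omega)),
    ← retired_congr (h.mono (show i + 1 ≤ _ by omega)),
    ← offer_congr (h.mono (show i + 1 ≤ _ by omega)) (hr v (self_mem_ball _ _ _))
      (ha v (self_mem_ball _ _ _)), ← ha v (self_mem_ball _ _ _)]
  by_cases hb : b ∈ W.bundles i v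
  · obtain ⟨u, hu, hub⟩ := mem_bundles.1 hb
    have hb' : b ∈ W.ball (1 + i) v := ball_trans (nbr_mem_ball hu) (mem_ball_of_center hub)
    rw [clusterFlow_congr (h.of_mem hb' (by omega))
      (fun x hx => hr x (ball_mono (by omega) v (ball_trans hb' hx)))
      (fun x hx => ha x (ball_mono (by omega) v (ball_trans hb' hx)))]
  · simp [hb]

theorem pairFlow_congr {v u y : α} (hy : y ∈ W.ball 1 v) (h : Agree W W' (3 * i + 3) v)
    (hr : ∀ x ∈ W.ball (2 * i + 2) v, rem x = rem' x)
    (ha : ∀ x ∈ W.ball (2 * i + 2) v, acc x = acc' x) :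
    W.pairFlow K ρ i rem acc u y = W'.pairFlow K ρ i rem' acc' u y := by
  unfold pairFlow
  rw [← center_congr (h.of_mem (r := i) hy (by omega))]
  cases hc : W.center i y with
  | none => rfl
  | some b =>
    have hb' : b ∈ W.ball (1 + i) v := ball_trans hy (mem_ball_of_center hc)
    simp only [Option.elim_some]
    rw [clusterFlow_congr (h.of_mem hb' (by omega))
      (fun x hx => hr x (ball_mono (by omega) v (ball_trans hb' hx)))
      (fun x hx => ha x (ball_mono (by omega) v (ball_trans hb' hx)))]

theorem opLoad_congr {v : α} (h : Agree W W' (3 * i + 3) v)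
    (hr : ∀ x ∈ W.ball (2 * i + 2) v, rem x = rem' x)
    (ha : ∀ x ∈ W.ball (2 * i + 2) v, acc x = acc' x) :
    W.opLoad K ρ i rem acc v = W'.opLoad K ρ i rem' acc' v := by
  classical
  unfold opLoad
  rw [← h.self]
  refine Finset.sum_congr rfl fun u hu => ?_
  rw [pairFlow_congr (nbr_mem_ball (List.mem_toFinset.1 hu)) h hr ha,
    pairFlow_congr (self_mem_ball _ _ _) h hr ha]

theorem accAfter_congr {r k : ℕ}
    (hr : ∀ x, Agree W W' r x → rem x = rem' x) (ha : ∀ x, Agree W W' r x → acc x = acc' x)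
    {v : α} (h : Agree W W' (r + k * (3 * i + 3)) v) :
    W.accAfter K ρ i rem acc k v = W'.accAfter K ρ i rem' acc' k v := by
  induction k generalizing v with
  | zero => exact ha v (by simpa using h)
  | succ k ih =>
    rw [Nat.succ_mul] at h
    exact accStep_congr (h.mono (by omega))
      (fun x hx => hr x (h.of_mem hx (by nlinarith)))
      (fun x hx => ih (h.of_mem hx (by omega)))

/-- Levels run in parallel, all reading the residuals from the start of the epoch. Level `i` uses
radius `s / (i + 1) * (3 * i + 3) ≤ 3 * s` per epoch. -/
theorem run_congr {s t : ℕ} {v : α} (h : Agree W W' (3 * s * t) v) :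
    (W.run s K ρ t).1 v = (W'.run s K ρ t).1 v ∧
      ∀ i, (W.run s K ρ t).2 i v = (W'.run s K ρ t).2 i v := by
  induction t generalizing v with
  | zero =>
    refine ⟨?_, fun _ => rfl⟩
    simp only [run]
    rw [h.self]
  | succ t ih =>
    have hq : ∀ i, s / (i + 1) * (3 * i + 3) ≤ 3 * s := fun i => by
      have := Nat.div_mul_le_self s (i + 1)
      nlinarith
    rw [Nat.mul_succ] at h
    have hacc : ∀ i k, k ≤ s / (i + 1) → ∀ x, Agree W W' (3 * s * t + k * (3 * i + 3)) x →
        W.accAfter K ρ i (W.run s K ρ t).1 ((W.run s K ρ t).2 i) k x =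
          W'.accAfter K ρ i (W'.run s K ρ t).1 ((W'.run s K ρ t).2 i) k x :=
      fun i k _ x hx => accAfter_congr (fun y hy => (ih hy).1) (fun y hy => (ih hy).2 i) hx
    refine ⟨?_, fun i => hacc i _ le_rfl v (h.mono (by have := hq i; omega))⟩
    simp only [run]
    rw [(ih (h.mono (by omega))).1]
    congr 1
    refine Finset.sum_congr rfl fun i _ => Finset.sum_congr rfl fun k hk => ?_
    have hk' : k < s / (i + 1) := Finset.mem_range.1 hk
    have h3 : k * (3 * i + 3) + (3 * i + 3) ≤ 3 * s := by
      have := hq i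
      have h4 : (k + 1) * (3 * i + 3) ≤ s / (i + 1) * (3 * i + 3) := Nat.mul_le_mul_right _ hk'
      nlinarith
    refine opLoad_congr (h.mono (by omega)) (fun x hx => (ih (h.of_mem hx (by omega))).1)
      fun x hx => hacc i k hk'.le x (h.of_mem hx (by omega))

end Locality

end World

/-! ### Maximal flows and the effect of one operation. -/

namespace World

variable {α : Type}

/-- Greedy: insert the edges one at a time and push as much as possible along each new edge. Tight
constraints stay tight. The bounds are proved at all vertices, not only at endpoints of `E`, for the
induction to go through. -/
theorem exists_isMaximalFlow {E : Set (α × α)} (hE : E.Finite) {a κ : α → ℝ} (ha : ∀ v, 0 ≤ a v)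
    (hκ : ∀ u, 0 ≤ κ u) : ∃ z, IsMaximalFlow E a κ z := by
  classical
  suffices h : ∃ z : α → α → ℝ, (∀ v u, 0 ≤ z v u) ∧ (∀ v u, z v u ≠ 0 → (v, u) ∈ E) ∧
      (∀ v, ∑ᶠ u, z v u ≤ a v) ∧ (∀ u, ∑ᶠ v, z v u ≤ κ u) ∧
      ∀ e ∈ E, ∑ᶠ u, z e.1 u = a e.1 ∨ ∑ᶠ v, z v e.2 = κ e.2 by
    obtain ⟨z, h1, h2, h3, h4, h5⟩ := h
    exact ⟨z, h1, h2, fun e _ => h3 _, fun e _ => h4 _, h5⟩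
  induction E, hE using Set.Finite.induction_on with
  | empty => exact ⟨fun _ _ => 0, by simp, by simp, by simpa using ha, by simpa using hκ, by simp⟩
  | @insert e E he hE ih =>
    obtain ⟨z, h1, h2, h3, h4, h5⟩ := ih
    obtain ⟨v₀, u₀⟩ := e
    -- The largest amount that the new edge can still carry.
    set δ := min (a v₀ - ∑ᶠ u, z v₀ u) (κ u₀ - ∑ᶠ v, z v u₀) with hδ
    have hδ0 : 0 ≤ δ := le_min (sub_nonneg.2 (h3 _)) (sub_nonneg.2 (h4 _))
    have hout : ∀ v, ∑ᶠ u, (z v u + if v = v₀ ∧ u = u₀ then δ else 0) =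
        ∑ᶠ u, z v u + if v = v₀ then δ else 0 := fun v => by
      rw [finsum_add_distrib]
      · congr 1
        rw [finsum_eq_single _ u₀ fun u hu => by simp [hu]]
        simp
      · exact (hE.image Prod.snd).subset fun u hu => ⟨(v, u), h2 _ _ hu, rfl⟩
      · refine (Set.finite_singleton u₀).subset fun u hu => ?_
        by_contra h
        exact hu (if_neg fun h' => h h'.2)
    have hin : ∀ u, ∑ᶠ v, (z v u + if v = v₀ ∧ u = u₀ then δ else 0) =
        ∑ᶠ v, z v u + if u = u₀ then δ else 0 := fun u => by
      rw [finsum_add_distrib]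
      · congr 1
        rw [finsum_eq_single _ v₀ fun v hv => by simp [hv]]
        simp
      · exact (hE.image Prod.fst).subset fun v hv => ⟨(v, u), h2 _ _ hv, rfl⟩
      · refine (Set.finite_singleton v₀).subset fun u hu => ?_
        by_contra h
        exact hu (if_neg fun h' => h h'.1)
    have hout' : ∀ v, ∑ᶠ u, z v u + (if v = v₀ then δ else 0) ≤ a v := fun v => by
      split_ifs with h
      · subst h
        linarith [min_le_left (a v - ∑ᶠ u, z v u) (κ u₀ - ∑ᶠ v, z v u₀)]
      · simpa using h3 v
    have hin' : ∀ u, ∑ᶠ v, z v u + (if u = u₀ then δ else 0) ≤ κ u := fun u => by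
      split_ifs with h
      · subst h
        linarith [min_le_right (a v₀ - ∑ᶠ u, z v₀ u) (κ u - ∑ᶠ v, z v u)]
      · simpa using h4 u
    refine ⟨fun v u => z v u + if v = v₀ ∧ u = u₀ then δ else 0, fun v u => ?_, fun v u h => ?_,
      fun v => (hout v).trans_le (hout' v), fun u => (hin u).trans_le (hin' u), fun e he => ?_⟩
    · exact add_nonneg (h1 v u) (by split_ifs <;> simp [hδ0])
    · by_cases hvu : v = v₀ ∧ u = u₀
      · exact Or.inl (by rw [hvu.1, hvu.2])
      · exact Or.inr (h2 v u (by simpa [hvu] using h))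
    · simp only [hout, hin]
      rcases he with rfl | he
      · rcases min_choice (a v₀ - ∑ᶠ u, z v₀ u) (κ u₀ - ∑ᶠ v, z v u₀) with h | h
        · left; simp only [if_true]; linarith
        · right; simp only [if_true]; linarith
      · refine (h5 e he).imp (fun h => le_antisymm (hout' _) ?_) fun h => le_antisymm (hin' _) ?_
        · rw [← h]
          exact le_add_of_nonneg_right (by split_ifs <;> simp [hδ0])
        · rw [← h]
          exact le_add_of_nonneg_right (by split_ifs <;> simp [hδ0])

theorem isMaximalFlow_maxFlow {E : Set (α × α)} (hE : E.Finite) {a κ : α → ℝ}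
    (ha : ∀ v, 0 ≤ a v) (hκ : ∀ u, 0 ≤ κ u) : IsMaximalFlow E a κ (maxFlow E a κ) := by
  classical
  have h := Classical.epsilon_spec (exists_isMaximalFlow (α := α) hE
    (a := fun v => if v ∈ Prod.fst '' E then a v else 0)
    (κ := fun u => if u ∈ Prod.snd '' E then κ u else 0)
    (fun v => by split_ifs <;> simp [ha]) fun v => by split_ifs <;> simp [hκ])
  have h' : IsMaximalFlow E (fun v => if v ∈ Prod.fst '' E then a v else 0)
    (fun u => if u ∈ Prod.snd '' E then κ u else 0) (maxFlow E a κ) := by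
    unfold maxFlow
    convert h
  have e1 : ∀ e ∈ E, (if e.1 ∈ Prod.fst '' E then a e.1 else 0) = a e.1 :=
    fun e he => if_pos ⟨e, he, rfl⟩
  have e2 : ∀ e ∈ E, (if e.2 ∈ Prod.snd '' E then κ e.2 else 0) = κ e.2 :=
    fun e he => if_pos ⟨e, he, rfl⟩
  exact ⟨h'.nonneg, h'.supp, fun e he => (h'.out_le e he).trans_eq (e1 e he),
    fun e he => (h'.in_le e he).trans_eq (e2 e he),
    fun e he => by simpa only [e1 e he, e2 e he] using h'.maximal e he⟩

/-- The neighbour lists of `W` describe an undirected graph on `U`. -/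
def IsNetwork (W : World α) (U : Finset α) : Prop :=
  ∀ a, ∀ x ∈ (W a).nbr, a ∈ U ∧ a ∈ (W x).nbr

variable {W : World α} {U : Finset α}

theorem ball_symm (hW : W.IsNetwork U) {r : ℕ} {x v : α} (h : x ∈ W.ball r v) :
    v ∈ W.ball r x := by
  induction r generalizing v with
  | zero => exact Eq.symm h
  | succ r ih =>
    rcases h with h | ⟨u, hu, h⟩
    · exact Or.inl (Eq.symm h)
    · exact ball_trans (ih h) (nbr_mem_ball (hW v u hu).2)

/-- The ball condition in `edgesTo` serves locality only: in a symmetric network it follows from the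
radius bound on clusters. -/
theorem mem_edgesTo (hW : W.IsNetwork U) {i : ℕ} {b v u : α} :
    (v, u) ∈ W.edgesTo i b ↔ u ∈ (W v).nbr ∧ W.Retired i v ∧ W.center i u = some b := by
  constructor
  · rintro ⟨_, h2, h3, h4⟩
    exact ⟨(hW _ _ h2).2, h3, h4⟩
  · rintro ⟨h1, h2, h3⟩
    exact ⟨ball_symm hW (mem_ball_of_center h3), (hW _ _ h1).2, h2, h3⟩

theorem finite_edgesTo (hW : W.IsNetwork U) {i : ℕ} {b : α} : (W.edgesTo i b).Finite := by
  refine (U ×ˢ U).finite_toSet.subset ?_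
  rintro ⟨v, u⟩ ⟨_, h2, -⟩
  have := hW _ _ h2
  simp only [Finset.coe_product, Set.mem_prod, Finset.mem_coe]
  exact ⟨(hW _ _ this.2).1, this.1⟩

section Operation

variable {K ρ : ℝ} {i : ℕ} {rem : α → ℝ} {acc : α → α → ℕ}

theorem offer_nonneg (hK : 0 ≤ K) (hρ : 0 ≤ ρ) (hr : ∀ v, 0 ≤ rem v) (v b : α) :
    0 ≤ W.offer K ρ i rem acc v b := by
  have := hr v
  unfold offer
  positivity

theorem isMaximalFlow_clusterFlow (hW : W.IsNetwork U) (hK : 0 ≤ K) (hρ : 0 ≤ ρ)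
    (hr : ∀ v, 0 ≤ rem v) (b : α) :
    IsMaximalFlow (W.edgesTo i b) (fun v => W.offer K ρ i rem acc v b) (fun u => ρ * rem u)
      (W.clusterFlow K ρ i rem acc b) :=
  isMaximalFlow_maxFlow (finite_edgesTo hW) (fun v => offer_nonneg hK hρ hr v b)
    fun u => mul_nonneg hρ (hr u)

theorem sum_offer_le (hρ : 0 ≤ ρ) (hr : ∀ v, 0 ≤ rem v) (v : α) :
    ∑ b ∈ W.bundles i v, W.offer K ρ i rem acc v b ≤ ρ * rem v := by
  unfold offer
  rw [← Finset.mul_sum, ← Finset.sum_div]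
  exact mul_le_of_le_one_right (mul_nonneg hρ (hr v)) (div_self_le_one _)

variable (hW : W.IsNetwork U) (hK : 1 ≤ K) (hρ : 0 ≤ ρ) (hr : ∀ v, 0 ≤ rem v)
include hW hK hρ hr

theorem clusterFlow_nonneg (b v u : α) : 0 ≤ W.clusterFlow K ρ i rem acc b v u :=
  (isMaximalFlow_clusterFlow hW (by linarith) hρ hr b).nonneg v u

theorem clusterFlow_supp {b v u : α} (h : W.clusterFlow K ρ i rem acc b v u ≠ 0) :
    u ∈ (W v).nbr ∧ W.Retired i v ∧ W.center i u = some b :=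
  (mem_edgesTo hW).1 ((isMaximalFlow_clusterFlow hW (by linarith) hρ hr b).supp v u h)

omit hK hρ hr in
theorem mem_of_nbr {v u : α} (h : u ∈ (W v).nbr) : v ∈ U ∧ u ∈ U :=
  ⟨(hW _ _ h).1, (hW _ _ (hW _ _ h).2).1⟩

theorem finsum_clusterFlow_out (b v : α) :
    ∑ᶠ u, W.clusterFlow K ρ i rem acc b v u = ∑ u ∈ U, W.clusterFlow K ρ i rem acc b v u :=
  finsum_eq_sum_of_support_subset _ fun _ hu =>
    (mem_of_nbr hW (clusterFlow_supp hW hK hρ hr hu).1).2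

theorem finsum_clusterFlow_in (b u : α) :
    ∑ᶠ v, W.clusterFlow K ρ i rem acc b v u = ∑ v ∈ U, W.clusterFlow K ρ i rem acc b v u :=
  finsum_eq_sum_of_support_subset _ fun _ hv =>
    (mem_of_nbr hW (clusterFlow_supp hW hK hρ hr hv).1).1

theorem pairFlow_nonneg (v u : α) : 0 ≤ W.pairFlow K ρ i rem acc v u := by
  unfold pairFlow
  cases W.center i u with
  | none => exact le_rfl
  | some b => exact clusterFlow_nonneg hW hK hρ hr b v u

theorem pairFlow_supp {v u : α} (h : W.pairFlow K ρ i rem acc v u ≠ 0) : u ∈ (W v).nbr := by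
  unfold pairFlow at h
  cases hc : W.center i u with
  | none => simp [hc] at h
  | some b => exact (clusterFlow_supp hW hK hρ hr (by simpa [hc] using h)).1

/-- Each `u` lies in at most one cluster, so the flows of different clusters never share a head. -/
theorem sum_pairFlow_out (v : α) :
    ∑ u ∈ U, W.pairFlow K ρ i rem acc v u =
      ∑ b ∈ W.bundles i v, ∑ᶠ u, W.clusterFlow K ρ i rem acc b v u := by
  simp_rw [finsum_clusterFlow_out hW hK hρ hr]
  rw [Finset.sum_comm]
  refine Finset.sum_congr rfl fun u _ => ?_
  unfold pairFlow
  cases hc : W.center i u with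
  | none =>
    refine (Finset.sum_eq_zero fun b _ => ?_).symm
    by_contra h
    have := (clusterFlow_supp hW hK hρ hr h).2.2
    simp [hc] at this
  | some b =>
    rw [Option.elim_some, Finset.sum_eq_single b (fun b' _ hb => ?_) fun hb => ?_]
    · by_contra h
      have := (clusterFlow_supp hW hK hρ hr h).2.2
      rw [hc, Option.some.injEq] at this
      exact hb this.symm
    · by_contra h
      exact hb (mem_bundles.2 ⟨u, (clusterFlow_supp hW hK hρ hr h).1, hc⟩)

theorem finsum_clusterFlow_le (b v : α) :
    ∑ᶠ u, W.clusterFlow K ρ i rem acc b v u ≤ W.offer K ρ i rem acc v b := by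
  by_cases h : ∃ u, W.clusterFlow K ρ i rem acc b v u ≠ 0
  · obtain ⟨u, hu⟩ := h
    have hz := isMaximalFlow_clusterFlow (K := K) (acc := acc) (i := i) hW (by linarith) hρ hr b
    exact hz.out_le (v, u) (hz.supp v u hu)
  · push Not at h
    simp only [h, finsum_zero]
    exact offer_nonneg (by linarith) hρ hr v b

theorem sum_pairFlow_out_le (v : α) : ∑ u ∈ U, W.pairFlow K ρ i rem acc v u ≤ ρ * rem v := by
  rw [sum_pairFlow_out hW hK hρ hr]
  exact (Finset.sum_le_sum fun b _ => finsum_clusterFlow_le hW hK hρ hr b v).trans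
    (sum_offer_le hρ hr v)

theorem sum_pairFlow_in_le (u : α) : ∑ v ∈ U, W.pairFlow K ρ i rem acc v u ≤ ρ * rem u := by
  unfold pairFlow
  cases hc : W.center i u with
  | none => simpa using mul_nonneg hρ (hr u)
  | some b =>
    simp only [Option.elim_some]
    rw [← finsum_clusterFlow_in hW hK hρ hr]
    by_cases h : ∃ v, W.clusterFlow K ρ i rem acc b v u ≠ 0
    · obtain ⟨v, hv⟩ := h
      have hz := isMaximalFlow_clusterFlow (K := K) (acc := acc) (i := i) hW (by linarith) hρ hr b
      exact hz.in_le (v, u) (hz.supp v u hv)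
    · push Not at h
      simpa [h] using mul_nonneg hρ (hr u)

theorem opLoad_eq (v : α) : W.opLoad K ρ i rem acc v =
    ∑ u ∈ U, (W.pairFlow K ρ i rem acc v u + W.pairFlow K ρ i rem acc u v) := by
  classical
  unfold opLoad
  refine Finset.sum_subset (fun u hu => (mem_of_nbr hW (List.mem_toFinset.1 hu)).2)
    fun u _ hu => ?_
  rw [List.mem_toFinset] at hu
  have h1 : W.pairFlow K ρ i rem acc v u = 0 := by
    by_contra h
    exact hu (pairFlow_supp hW hK hρ hr h)
  have h2 : W.pairFlow K ρ i rem acc u v = 0 := by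
    by_contra h
    exact hu (hW _ _ (pairFlow_supp hW hK hρ hr h)).2
  rw [h1, h2, add_zero]

theorem opLoad_nonneg (v : α) : 0 ≤ W.opLoad K ρ i rem acc v :=
  Finset.sum_nonneg fun u _ =>
    add_nonneg (pairFlow_nonneg hW hK hρ hr v u) (pairFlow_nonneg hW hK hρ hr u v)

theorem opLoad_le (v : α) : W.opLoad K ρ i rem acc v ≤ 2 * ρ * rem v := by
  rw [opLoad_eq hW hK hρ hr, Finset.sum_add_distrib]
  linarith [sum_pairFlow_in_le (acc := acc) (i := i) hW hK hρ hr v,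
    sum_pairFlow_out_le (acc := acc) (i := i) hW hK hρ hr v]

theorem sum_out_le_opLoad (v : α) :
    ∑ u ∈ U, W.pairFlow K ρ i rem acc v u ≤ W.opLoad K ρ i rem acc v := by
  rw [opLoad_eq hW hK hρ hr]
  exact Finset.sum_le_sum fun u _ => le_add_of_nonneg_right (pairFlow_nonneg hW hK hρ hr u v)

theorem sum_in_le_opLoad (u : α) :
    ∑ v ∈ U, W.pairFlow K ρ i rem acc v u ≤ W.opLoad K ρ i rem acc u := by
  rw [opLoad_eq hW hK hρ hr]
  exact Finset.sum_le_sum fun v _ => le_add_of_nonneg_left (pairFlow_nonneg hW hK hρ hr u v)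

/-- Either the offer of `v` to the cluster of its neighbour `u` is accepted, or `u` is saturated. -/
theorem accStep_or_saturated {v u b : α} (hv : W.Retired i v) (hu : u ∈ (W v).nbr)
    (hb : W.center i u = some b) :
    W.accStep K ρ i rem acc v b = acc v b + 1 ∨ ρ * rem u ≤ W.opLoad K ρ i rem acc u := by
  have hz := isMaximalFlow_clusterFlow (K := K) (acc := acc) (i := i) hW (by linarith) hρ hr b
  rcases hz.maximal (v, u) ((mem_edgesTo hW).2 ⟨hu, hv, hb⟩) with h | h
  · left
    exact if_pos ⟨mem_bundles.2 ⟨u, hu, hb⟩, hv, h⟩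
  · right
    refine le_trans (le_of_eq ?_) (sum_in_le_opLoad hW hK hρ hr u)
    simp only [pairFlow, hb, Option.elim_some]
    rw [← finsum_clusterFlow_in hW hK hρ hr]
    exact h.symm

omit hW hK hρ hr in
theorem le_accStep (v b : α) : acc v b ≤ W.accStep K ρ i rem acc v b := by
  unfold accStep
  split_ifs <;> omega

omit hW hρ hr in
theorem potential_pos {v u b : α} (hu : u ∈ (W v).nbr)
    (hb : W.center i u = some b) : K ^ acc v b ≤ ∑ b' ∈ W.bundles i v, K ^ acc v b' :=
  Finset.single_le_sum (f := fun b' => K ^ acc v b') (fun _ _ => by positivity)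
    (mem_bundles.2 ⟨u, hu, hb⟩)

omit hW hρ hr in
theorem potential_step (v : α) :
    ∑ b ∈ W.bundles i v, K ^ W.accStep K ρ i rem acc v b ≤
      K * ∑ b ∈ W.bundles i v, K ^ acc v b := by
  rw [Finset.mul_sum]
  refine Finset.sum_le_sum fun b _ => ?_
  unfold accStep
  split_ifs
  · rw [pow_succ']
  · exact le_mul_of_one_le_left (by positivity) hK

/-- Either the potential of `v` at most doubles, or a `1 / K` fraction of its offer is accepted. -/
theorem potential_step_or {v : α} (hv : W.Retired i v) :
    ∑ b ∈ W.bundles i v, K ^ W.accStep K ρ i rem acc v b ≤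
      2 * ∑ b ∈ W.bundles i v, K ^ acc v b ∨ ρ * rem v / K ≤ W.opLoad K ρ i rem acc v := by
  classical
  by_cases hgood : ρ * rem v / K ≤ W.opLoad K ρ i rem acc v
  · exact Or.inr hgood
  left
  push Not at hgood
  set A := (W.bundles i v).filter fun b =>
    ∑ᶠ u, W.clusterFlow K ρ i rem acc b v u = W.offer K ρ i rem acc v b with hA
  set X := ∑ b ∈ W.bundles i v, K ^ acc v b with hX
  have hstep : ∀ b ∈ W.bundles i v, K ^ W.accStep K ρ i rem acc v b =
      K ^ acc v b + if ∑ᶠ u, W.clusterFlow K ρ i rem acc b v u = W.offer K ρ i rem acc v b then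
        (K - 1) * K ^ acc v b else 0 := fun b hb => by
    unfold accStep
    simp only [hb, hv, true_and]
    split_ifs
    · rw [pow_succ]; ring
    · simp
  rw [Finset.sum_congr rfl hstep, Finset.sum_add_distrib, ← Finset.sum_filter, ← Finset.mul_sum]
  have hpos : 0 < ρ * rem v := by
    rcases (mul_nonneg hρ (hr v)).lt_or_eq with h | h
    · exact h
    · rw [← h, zero_div] at hgood
      exact absurd (opLoad_nonneg hW hK hρ hr v) (not_le.2 hgood)
  have hX0 : 0 ≤ X := Finset.sum_nonneg fun b _ => by positivity
  have hsum : ρ * rem v * ((∑ b ∈ A, K ^ acc v b) / X) ≤ W.opLoad K ρ i rem acc v := by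
    refine le_trans ?_ (sum_out_le_opLoad hW hK hρ hr v)
    rw [sum_pairFlow_out hW hK hρ hr, Finset.sum_div, Finset.mul_sum]
    calc ∑ b ∈ A, ρ * rem v * (K ^ acc v b / X)
        = ∑ b ∈ A, ∑ᶠ u, W.clusterFlow K ρ i rem acc b v u :=
          Finset.sum_congr rfl fun b hb => ((Finset.mem_filter.1 hb).2).symm
      _ ≤ _ := Finset.sum_le_sum_of_subset_of_nonneg (Finset.filter_subset _ _)
          fun b _ _ => finsum_nonneg fun u => clusterFlow_nonneg hW hK hρ hr b v u
  have hlt := hsum.trans_lt hgood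
  rw [div_eq_mul_inv (ρ * rem v)] at hlt
  -- The accepted bundles hold less than a `1 / K` share of the potential, so multiplying their
  -- terms by `K` adds at most the old potential.
  have hfrac := lt_of_mul_lt_mul_left hlt hpos.le
  rcases hX0.lt_or_eq with hX0 | hX0
  · rw [div_lt_iff₀ hX0, inv_mul_eq_div, lt_div_iff₀ (by linarith)] at hfrac
    have : 0 ≤ ∑ b ∈ A, K ^ acc v b := Finset.sum_nonneg fun b _ => by positivity
    change X + (K - 1) * ∑ b ∈ A, K ^ acc v b ≤ 2 * X
    nlinarith
  · have : ∑ b ∈ A, K ^ acc v b ≤ X := Finset.sum_le_sum_of_subset_of_nonneg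
      (Finset.filter_subset _ _) fun b _ _ => by positivity
    change X + (K - 1) * ∑ b ∈ A, K ^ acc v b ≤ 2 * X
    nlinarith

/-- One saturation during an epoch is enough: the dichotomy is used per epoch, since the residuals
stay fixed within it. -/
theorem accAfter_or_saturated {v u b : α} (hv : W.Retired i v) (hu : u ∈ (W v).nbr)
    (hb : W.center i u = some b) (q : ℕ) :
    acc v b + q ≤ W.accAfter K ρ i rem acc q v b ∨
      ∃ k < q, ρ * rem u ≤ W.opLoad K ρ i rem (W.accAfter K ρ i rem acc k) u := by
  induction q with
  | zero => exact Or.inl le_rfl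
  | succ q ih =>
    rcases ih with ih | ⟨k, hk, h⟩
    · rcases accStep_or_saturated (acc := W.accAfter K ρ i rem acc q) hW hK hρ hr hv hu hb
        with h | h
      · left
        simp only [accAfter, h]
        omega
      · exact Or.inr ⟨q, Nat.lt_succ_self q, h⟩
    · exact Or.inr ⟨k, hk.trans (Nat.lt_succ_self q), h⟩

omit hW hK hρ hr in
theorem le_accAfter (v b : α) (q : ℕ) : acc v b ≤ W.accAfter K ρ i rem acc q v b := by
  induction q with
  | zero => exact le_rfl
  | succ q ih => exact ih.trans (le_accStep v b)

omit hW hρ hr in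
theorem potential_accAfter (v : α) (q : ℕ) :
    ∑ b ∈ W.bundles i v, K ^ W.accAfter K ρ i rem acc q v b ≤
      K ^ q * ∑ b ∈ W.bundles i v, K ^ acc v b := by
  induction q with
  | zero => simp [accAfter]
  | succ q ih =>
    refine (potential_step hK v).trans ?_
    rw [pow_succ', mul_assoc]
    exact mul_le_mul_of_nonneg_left ih (by linarith)

theorem potential_accAfter_or {v : α} (hv : W.Retired i v) (q : ℕ) :
    ∑ b ∈ W.bundles i v, K ^ W.accAfter K ρ i rem acc q v b ≤
        2 ^ q * ∑ b ∈ W.bundles i v, K ^ acc v b ∨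
      ∃ k < q, ρ * rem v / K ≤ W.opLoad K ρ i rem (W.accAfter K ρ i rem acc k) v := by
  induction q with
  | zero => exact Or.inl (by simp [accAfter])
  | succ q ih =>
    rcases ih with ih | ⟨k, hk, h⟩
    · rcases potential_step_or (acc := W.accAfter K ρ i rem acc q) hW hK hρ hr hv with h | h
      · left
        refine h.trans ?_
        rw [pow_succ', mul_assoc]
        exact mul_le_mul_of_nonneg_left ih (by norm_num)
      · exact Or.inr ⟨q, Nat.lt_succ_self q, h⟩
    · exact Or.inr ⟨k, hk.trans (Nat.lt_succ_self q), h⟩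

end Operation

end World

/-! ### Retirement, and progress over the epochs. -/

namespace World

variable {α : Type} {W : World α} {U : Finset α}

theorem center_eq_none_of_le {i j : ℕ} (hij : i ≤ j) {a : α} (h : W.center i a = none) :
    W.center j a = none := by
  induction j, hij using Nat.le_induction with
  | base => exact h
  | succ j _ ih => simp [center, ih]

/-- A center at level `i` has survived all earlier levels; this bounds the chance that a level is
nonempty. -/
theorem bit_of_center {i : ℕ} {a b : α} (h : W.center i a = some b) :
    ∀ j < i, (W b).bit j = true := by
  induction i generalizing a with
  | zero => simp
  | succ i ih =>
    simp only [center, Option.bind_eq_some_iff] at h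
    obtain ⟨c, hc, h⟩ := h
    have key : (∃ a', W.center i a' = some b) ∧ (W b).bit i = true := by
      split_ifs at h with hb
      · obtain rfl : c = b := by simpa using h
        exact ⟨⟨a, hc⟩, hb⟩
      · obtain ⟨u, -, hub⟩ := List.mem_filterMap.1 (List.mem_of_find?_eq_some h)
        exact ⟨⟨u, hub⟩, List.find?_some (p := fun b => (W b).bit i) h⟩
    intro j hj
    rcases Nat.lt_succ_iff_lt_or_eq.1 hj with hj | rfl
    · obtain ⟨⟨a', ha'⟩, -⟩ := key
      exact ih ha' j hj
    · exact key.2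

theorem exists_retired {s : ℕ} {a : α} (h : W.center s a = none) : ∃ i < s, W.Retired i a := by
  induction s with
  | zero => simp [center] at h
  | succ s ih =>
    by_cases hs : W.center s a = none
    · obtain ⟨i, hi, hr⟩ := ih hs
      exact ⟨i, hi.trans (Nat.lt_succ_self s), hr⟩
    · exact ⟨s, Nat.lt_succ_self s, Option.isSome_iff_ne_none.2 hs, h⟩

/-- Otherwise the node would have joined that surviving cluster. This is what makes retirement next
to many clusters unlikely. -/
theorem Retired.bit_eq_false {i : ℕ} {v b : α} (h : W.Retired i v) (hb : b ∈ W.bundles i v) :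
    (W b).bit i = false := by
  obtain ⟨c, hc⟩ := Option.isSome_iff_exists.1 h.1
  have h2 := h.2
  simp only [center, hc, Option.bind_some] at h2
  split_ifs at h2 with hbit
  obtain ⟨u, hu, hub⟩ := mem_bundles.1 hb
  have := List.find?_eq_none.1 h2 b (List.mem_filterMap.2 ⟨u, hu, hub⟩)
  simpa using this

section Run

variable {s : ℕ} {K ρ : ℝ} (hW : W.IsNetwork U) (hK : 1 ≤ K) (hρ : 0 ≤ ρ)
  (hρs : 2 * ρ * (s : ℝ) ^ 2 ≤ 1)
include hW hK hρ hρs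

/-- There are at most `s ^ 2` operations per epoch, each loading a node by at most `2 * ρ * rem v`.
The bound on `ρ` keeps residuals non-negative although all operations ignore each other. -/
theorem run_load_bounds {rem : α → ℝ} (hr : ∀ v, 0 ≤ rem v) (acc : ℕ → ℕ → α → α → ℕ) (v : α) :
    ∑ i ∈ Finset.range s, ∑ k ∈ Finset.range (s / (i + 1)), W.opLoad K ρ i rem (acc i k) v ≤
        rem v ∧
      ∀ i < s, ∀ k < s / (i + 1), W.opLoad K ρ i rem (acc i k) v ≤
        ∑ i ∈ Finset.range s, ∑ k ∈ Finset.range (s / (i + 1)),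
          W.opLoad K ρ i rem (acc i k) v := by
  constructor
  · calc _ ≤ ∑ i ∈ Finset.range s, (s : ℝ) * (2 * ρ * rem v) := by
          refine Finset.sum_le_sum fun i _ => ?_
          refine (Finset.sum_le_sum fun k _ => opLoad_le hW hK hρ hr v).trans ?_
          rw [Finset.sum_const, Finset.card_range, nsmul_eq_mul]
          refine mul_le_mul_of_nonneg_right (Nat.cast_le.2 (Nat.div_le_self _ _)) ?_
          have := hr v
          positivity
      _ = 2 * ρ * (s : ℝ) ^ 2 * rem v := by
          rw [Finset.sum_const, Finset.card_range, nsmul_eq_mul]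
          ring
      _ ≤ rem v := mul_le_of_le_one_left (hr v) hρs
  · intro i hi k hk
    refine le_trans ?_ (Finset.single_le_sum
      (f := fun i => ∑ k ∈ Finset.range (s / (i + 1)), W.opLoad K ρ i rem (acc i k) v)
      (fun i _ => Finset.sum_nonneg fun k _ => opLoad_nonneg hW hK hρ hr v)
      (Finset.mem_range.2 hi))
    exact Finset.single_le_sum (f := fun k => W.opLoad K ρ i rem (acc i k) v)
      (fun k _ => opLoad_nonneg hW hK hρ hr v) (Finset.mem_range.2 hk)

theorem run_rem_nonneg (t : ℕ) (v : α) : 0 ≤ (W.run s K ρ t).1 v := by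
  induction t generalizing v with
  | zero => exact (W v).wt.2
  | succ t ih =>
    have := (run_load_bounds hW hK hρ hρs ih
      (fun i k => W.accAfter K ρ i (W.run s K ρ t).1 ((W.run s K ρ t).2 i) k) v).1
    simp only [run]
    linarith

theorem run_rem_antitone (t : ℕ) (v : α) : (W.run s K ρ (t + 1)).1 v ≤ (W.run s K ρ t).1 v := by
  simp only [run]
  exact sub_le_self _ (Finset.sum_nonneg fun i _ => Finset.sum_nonneg fun k _ =>
    opLoad_nonneg hW hK hρ (run_rem_nonneg hW hK hρ hρs t) v)

theorem run_rem_le_of_opLoad {t i k : ℕ} (hi : i < s) (hk : k < s / (i + 1)) {v : α} {x : ℝ}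
    (h : x ≤ W.opLoad K ρ i (W.run s K ρ t).1
      (W.accAfter K ρ i (W.run s K ρ t).1 ((W.run s K ρ t).2 i) k) v) :
    (W.run s K ρ (t + 1)).1 v ≤ (W.run s K ρ t).1 v - x := by
  have := (run_load_bounds hW hK hρ hρs (run_rem_nonneg hW hK hρ hρs t)
    (fun i k => W.accAfter K ρ i (W.run s K ρ t).1 ((W.run s K ρ t).2 i) k) v).2 i hi k hk
  simp only [run]
  linarith

/-- The residual weights come from an edge packing. -/
theorem exists_packing (t : ℕ) : ∃ Y : α → α → ℝ, (∀ v u, 0 ≤ Y v u) ∧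
    (∀ v u, Y v u ≠ 0 → u ∈ (W v).nbr) ∧
    ∀ v, ((W v).wt : ℝ) - (W.run s K ρ t).1 v = ∑ u ∈ U, (Y v u + Y u v) := by
  induction t with
  | zero => exact ⟨fun _ _ => 0, by simp, by simp, by simp [run]⟩
  | succ t ih =>
    obtain ⟨Y, h1, h2, h3⟩ := ih
    have hr := run_rem_nonneg hW hK hρ hρs t
    set z : ℕ → ℕ → α → α → ℝ := fun i k => W.pairFlow K ρ i (W.run s K ρ t).1
      (W.accAfter K ρ i (W.run s K ρ t).1 ((W.run s K ρ t).2 i) k) with hz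
    refine ⟨fun v u => Y v u + ∑ i ∈ Finset.range s, ∑ k ∈ Finset.range (s / (i + 1)), z i k v u,
      fun v u => ?_, fun v u h => ?_, fun v => ?_⟩
    · exact add_nonneg (h1 v u) (Finset.sum_nonneg fun i _ => Finset.sum_nonneg fun k _ =>
        pairFlow_nonneg hW hK hρ hr v u)
    · by_contra hu
      refine h ?_
      have hY : Y v u = 0 := by
        by_contra h'
        exact hu (h2 v u h')
      beta_reduce
      rw [hY, zero_add]
      refine Finset.sum_eq_zero fun i _ => Finset.sum_eq_zero fun k _ => ?_
      by_contra h'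
      exact hu (pairFlow_supp hW hK hρ hr h')
    · simp only [run]
      rw [sub_sub_eq_add_sub, add_sub_right_comm, h3 v]
      have : ∀ u, (Y v u + ∑ i ∈ Finset.range s, ∑ k ∈ Finset.range (s / (i + 1)), z i k v u) +
          (Y u v + ∑ i ∈ Finset.range s, ∑ k ∈ Finset.range (s / (i + 1)), z i k u v) =
          (Y v u + Y u v) + ∑ i ∈ Finset.range s, ∑ k ∈ Finset.range (s / (i + 1)),
            (z i k v u + z i k u v) := fun u => by
        simp only [Finset.sum_add_distrib]
        ring
      simp only [this]
      rw [Finset.sum_add_distrib (f := fun u => Y v u + Y u v)]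
      congr 1
      rw [Finset.sum_comm]
      refine Finset.sum_congr rfl fun i _ => ?_
      rw [Finset.sum_comm]
      exact Finset.sum_congr rfl fun k _ => opLoad_eq hW hK hρ hr v

/-- `S` counts the epochs in which `u` gets saturated, `N` those in which a sizeable fraction of
some offer of `v` is accepted. -/
theorem run_progress (hρ1 : ρ ≤ 1) {i : ℕ} (hi : i < s) {v u b : α} (hv : W.Retired i v)
    (hu : u ∈ (W v).nbr) (hb : W.center i u = some b) (t : ℕ) : ∃ S N : ℕ,
      s / (i + 1) * t ≤ (W.run s K ρ t).2 i v b + s / (i + 1) * S ∧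
      (W.run s K ρ t).1 u ≤ (1 - ρ) ^ S * (W u).wt ∧
      ∑ b' ∈ W.bundles i v, K ^ (W.run s K ρ t).2 i v b' ≤
        (W.bundles i v).card * 2 ^ (s / (i + 1) * t) * K ^ (s / (i + 1) * N) ∧
      (W.run s K ρ t).1 v ≤ (1 - ρ / K) ^ N * (W v).wt := by
  induction t with
  | zero => exact ⟨0, 0, by simp, by simp [run], by simp [run], by simp [run]⟩
  | succ t ih =>
    obtain ⟨S, N, h1, h2, h3, h4⟩ := ih
    set q := s / (i + 1) with hq
    have hr := run_rem_nonneg hW hK hρ hρs t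
    have hρK : ρ / K ≤ 1 := (div_le_one (by linarith)).2 (by linarith)
    have hacc : (W.run s K ρ (t + 1)).2 i =
      W.accAfter K ρ i (W.run s K ρ t).1 ((W.run s K ρ t).2 i) q := rfl
    have hmono := run_rem_antitone hW hK hρ hρs t
    obtain ⟨S', hS1, hS2⟩ : ∃ S', q * (t + 1) ≤ (W.run s K ρ (t + 1)).2 i v b + q * S' ∧
        (W.run s K ρ (t + 1)).1 u ≤ (1 - ρ) ^ S' * (W u).wt := by
      rw [hacc]
      rcases accAfter_or_saturated (acc := (W.run s K ρ t).2 i) hW hK hρ hr hv hu hb q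
        with h | ⟨k, hk, h⟩
      · exact ⟨S, by rw [mul_add]; omega, (hmono u).trans h2⟩
      · refine ⟨S + 1, ?_, ?_⟩
        · have := le_accAfter (W := W) (K := K) (ρ := ρ) (i := i) (rem := (W.run s K ρ t).1)
            (acc := (W.run s K ρ t).2 i) v b q
          rw [mul_add, mul_add]
          omega
        · have := run_rem_le_of_opLoad hW hK hρ hρs hi hk h
          calc _ ≤ (1 - ρ) * (W.run s K ρ t).1 u := by linarith
            _ ≤ (1 - ρ) * ((1 - ρ) ^ S * (W u).wt) :=
              mul_le_mul_of_nonneg_left h2 (by linarith)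
            _ = _ := by ring
    obtain ⟨N', hN1, hN2⟩ : ∃ N', ∑ b' ∈ W.bundles i v, K ^ (W.run s K ρ (t + 1)).2 i v b' ≤
          (W.bundles i v).card * 2 ^ (q * (t + 1)) * K ^ (q * N') ∧
        (W.run s K ρ (t + 1)).1 v ≤ (1 - ρ / K) ^ N' * (W v).wt := by
      rw [hacc]
      rcases potential_accAfter_or (acc := (W.run s K ρ t).2 i) hW hK hρ hr hv q
        with h | ⟨k, hk, h⟩
      · refine ⟨N, h.trans ?_, (hmono v).trans h4⟩
        calc _ ≤ 2 ^ q * ((W.bundles i v).card * 2 ^ (q * t) * K ^ (q * N)) := by gcongr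
          _ = _ := by rw [mul_add, mul_one, pow_add]; ring
      -- In such an epoch the potential may grow by the trivial factor `K ^ q`, which is charged to
      -- `N`.
      · refine ⟨N + 1, (potential_accAfter hK v q).trans ?_, ?_⟩
        · calc _ ≤ K ^ q * ((W.bundles i v).card * 2 ^ (q * t) * K ^ (q * N)) := by gcongr
            _ ≤ K ^ q * ((W.bundles i v).card * 2 ^ (q * (t + 1)) * K ^ (q * N)) := by
              gcongr
              · norm_num
              · omega
            _ = _ := by rw [mul_add q N, mul_one, pow_add K]; ring
        · have := run_rem_le_of_opLoad hW hK hρ hρs hi hk h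
          calc _ ≤ (1 - ρ / K) * (W.run s K ρ t).1 v := by
                rw [sub_mul, one_mul, div_mul_eq_mul_div]; exact this
            _ ≤ (1 - ρ / K) * ((1 - ρ / K) ^ N * (W v).wt) :=
              mul_le_mul_of_nonneg_left h4 (by linarith)
            _ = _ := by ring
    exact ⟨S', N', hS1, hS2, hN1, hN2⟩

omit hW hK hρ hρs in
theorem mul_lt_log_of_lt_pow {x δ r w : ℝ} {m : ℕ} (hδ : 0 < δ) (hx1 : x ≤ 1)
    (hw : 0 ≤ w) (h : δ * w < r) (hr : r ≤ (1 - x) ^ m * w) : x * m < Real.log (1 / δ) := by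
  have h1 : δ < (1 - x) ^ m := lt_of_mul_lt_mul_right (h.trans_le hr) hw
  have h2 : (1 - x) ^ m ≤ Real.exp (-(x * m)) := by
    calc (1 - x) ^ m ≤ Real.exp (-x) ^ m :=
          pow_le_pow_left₀ (by linarith) (Real.one_sub_le_exp_neg x) m
      _ = Real.exp (-(x * m)) := by rw [← Real.exp_nat_mul]; ring_nf
  have h3 := (Real.log_lt_iff_lt_exp hδ).2 (h1.trans_le h2)
  rw [one_div, Real.log_inv]
  linarith

/-- After sufficiently many epochs, every edge has an endpoint with little residual weight. -/
theorem run_covers (hρ0 : 0 < ρ) (hρ1 : ρ ≤ 1) (hK4 : 4 ≤ K) {D : ℕ → ℝ} {δ : ℝ} {T : ℕ}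
    (hδ : 0 < δ)
    (hD : ∀ i < s, ∀ v ∈ U, W.Retired i v → ((W.bundles i v).card : ℝ) ≤ D i)
    (hs : ∀ a ∈ U, W.center s a = none)
    (hT : ∀ i < s, 2 * Real.log (D i) +
      4 * K * Real.log (1 / δ) / ρ * ((s / (i + 1) : ℕ) : ℝ) * Real.log K ≤
        ((s / (i + 1) : ℕ) : ℝ) * T * Real.log K)
    {v u : α} (hvu : u ∈ (W v).nbr) :
    (W.run s K ρ T).1 v ≤ δ * (W v).wt ∨ (W.run s K ρ T).1 u ≤ δ * (W u).wt := by
  by_contra! hcon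
  have key : ∀ i < s, ∀ v u, u ∈ (W v).nbr → W.Retired i v → W.center i u ≠ none →
      δ * (W v).wt < (W.run s K ρ T).1 v → δ * (W u).wt < (W.run s K ρ T).1 u → False := by
    intro i hi v u hvu hv hu hrv hru
    obtain ⟨b, hb⟩ := Option.ne_none_iff_exists'.1 hu
    obtain ⟨S, N, h1, h2, h3, h4⟩ := run_progress hW hK hρ hρs hρ1 hi hv hvu hb T
    have hDi := hD i hi v (hW v u hvu).1 hv
    have hTi := hT i hi
    have hq : 0 < s / (i + 1) := Nat.div_pos hi (Nat.succ_pos i)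
    set q := s / (i + 1)
    have hS := mul_lt_log_of_lt_pow hδ hρ1 (W u).wt.2 hru h2
    have hN := mul_lt_log_of_lt_pow hδ ((div_le_one (by linarith)).2 (by linarith))
      (W v).wt.2 hrv h4
    set c := (W.bundles i v).card
    have hc : 0 < c := Finset.card_pos.2 ⟨b, mem_bundles.2 ⟨u, hvu, hb⟩⟩
    have hc' : (0 : ℝ) < c := Nat.cast_pos.2 hc
    have hcD : Real.log c ≤ Real.log (D i) := Real.log_le_log hc' hDi
    have hX := (potential_pos hK hvu hb).trans h3
    -- The term of `b` is below the whole potential. Since `4 ≤ K`, the factor `2 ^ (q * T)` absorbs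
    -- at most half of the left exponent; the other half must be paid by `log c` and by `S + N`,
    -- which are too small.
    have hpow : K ^ (q * T) ≤ c * 2 ^ (q * T) * K ^ (q * N) * K ^ (q * S) := by
      calc K ^ (q * T) ≤ K ^ ((W.run s K ρ T).2 i v b + q * S) := pow_le_pow_right₀ hK h1
        _ = K ^ (W.run s K ρ T).2 i v b * K ^ (q * S) := pow_add _ _ _
        _ ≤ _ := mul_le_mul_of_nonneg_right hX (by positivity)
    have hK0 : 0 < K := by linarith
    have hlog := Real.log_le_log (by positivity) hpow
    rw [Real.log_mul (by positivity) (by positivity), Real.log_mul (by positivity) (by positivity),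
      Real.log_mul (by positivity) (by positivity)] at hlog
    simp only [Real.log_pow] at hlog
    push_cast at hlog
    have hl2 : 2 * Real.log 2 ≤ Real.log K := by
      rw [show 2 * Real.log 2 = Real.log (2 ^ 2) by rw [Real.log_pow]; norm_num]
      exact Real.log_le_log (by norm_num) (by linarith)
    have hlK : 0 < Real.log K := Real.log_pos (by linarith)
    have hq' : (0 : ℝ) < q := Nat.cast_pos.2 hq
    set l := Real.log (1 / δ)
    have hS' : (S : ℝ) < l / ρ := by rw [lt_div_iff₀ hρ0]; linarith
    have hN' : (N : ℝ) < K * (l / ρ) := by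
      rw [div_mul_eq_mul_div, div_lt_iff₀ hK0] at hN
      rw [← mul_div_assoc, lt_div_iff₀ hρ0]
      linarith
    have hl0 : 0 ≤ l / ρ := (Nat.cast_nonneg S).trans hS'.le
    have hSN : (S : ℝ) + N < 2 * K * (l / ρ) := by nlinarith
    have e1 : q * Real.log K * (S + N) < q * Real.log K * (2 * K * (l / ρ)) :=
      mul_lt_mul_of_pos_left hSN (by positivity)
    have e2 : q * T * (2 * Real.log 2) ≤ q * T * Real.log K :=
      mul_le_mul_of_nonneg_left hl2 (by positivity)
    have e3 : 4 * K * l / ρ * q * Real.log K = 2 * (q * Real.log K * (2 * K * (l / ρ))) := by ring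
    rw [e3] at hTi
    nlinarith
  obtain ⟨hvU, huv⟩ := hW v u hvu
  obtain ⟨i, hi, hri⟩ := exists_retired (hs v hvU)
  obtain ⟨j, hj, hrj⟩ := exists_retired (hs u (hW u v huv).1)
  -- The endpoint that retires first owns the edge, and the other one is still clustered at that
  -- level.
  rcases le_total i j with hij | hij
  · exact key i hi v u hvu hri
      (fun h => by simp [center_eq_none_of_le hij h, Retired] at hrj) hcon.1 hcon.2
  · exact key j hj u v huv hrj
      (fun h => by simp [center_eq_none_of_le hij h, Retired] at hri) hcon.2 hcon.1

end Run

end World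

/-! ### Networks under relabelling of nodes. -/

/-- Rename the neighbours. -/
def NodeRecord.map {α β : Type} (f : α → β) (r : NodeRecord α) : NodeRecord β :=
  ⟨r.nbr.map f, r.wt, r.bit⟩

namespace World

variable {α β : Type}

open scoped Classical in
/-- The image of a network under a map of nodes, without edges outside the range. -/
noncomputable def map (f : α → β) (W : World α) : World β := fun b =>
  if h : ∃ a, f a = b then (W h.choose).map f else ⟨[], 0, fun _ => false⟩

variable {f : α → β} (hf : Function.Injective f) {W : World α}
include hf

theorem map_apply (W : World α) (a : α) : W.map f (f a) = (W a).map f := by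
  have h : ∃ a', f a' = f a := ⟨a, rfl⟩
  rw [map, dif_pos h, hf h.choose_spec]

/-- Clustering breaks ties by list order, never by names, so it commutes with injective relabelling.
Only the clustering is transported: the flows chosen by `epsilon` need not be, and are analysed
directly on the relabelled network. -/
theorem center_map (i : ℕ) (a : α) : (W.map f).center i (f a) = (W.center i a).map f := by
  induction i generalizing a with
  | zero => rfl
  | succ i ih =>
    have hlist : ((W.map f) (f a)).nbr.filterMap ((W.map f).center i) =
        ((W a).nbr.filterMap (W.center i)).map f := by
      rw [map_apply hf]
      simp only [NodeRecord.map, List.filterMap_map, List.map_filterMap]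
      exact List.filterMap_congr fun u _ => ih u
    simp only [center, hlist, ih]
    cases W.center i a with
    | none => rfl
    | some b =>
      have hbit : ∀ c, ((W.map f) (f c)).bit i = (W c).bit i := fun c => by
        rw [map_apply hf]; rfl
      simp only [Option.map_some, Option.bind_some, hbit]
      split_ifs
      · rfl
      · rw [List.find?_map]
        congr 2
        ext c
        exact hbit c

theorem retired_map {i : ℕ} {a : α} : (W.map f).Retired i (f a) ↔ W.Retired i a := by
  unfold Retired
  rw [center_map hf, center_map hf]
  simp

theorem card_bundles_map (i : ℕ) (a : α) :
    ((W.map f).bundles i (f a)).card ≤ (W.bundles i a).card := by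
  classical
  have : (W.map f).bundles i (f a) ⊆ (W.bundles i a).image f := fun b hb => by
    obtain ⟨u, hu, hub⟩ := mem_bundles.1 hb
    rw [map_apply hf] at hu
    obtain ⟨u, huW, rfl⟩ : ∃ u' ∈ (W a).nbr, f u' = u := List.mem_map.1 hu
    rw [center_map hf, Option.map_eq_some_iff] at hub
    obtain ⟨c, hc, rfl⟩ := hub
    exact Finset.mem_image_of_mem f (mem_bundles.2 ⟨u, huW, hc⟩)
  exact (Finset.card_le_card this).trans Finset.card_image_le

end World

/-! ### Gathering a ball by message passing. -/

/-- The state of a node that collects the records of all nodes in its surroundings. -/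
structure GossipState (α : Type) where
  id : α
  record : NodeRecord α
  known : Set (α × NodeRecord α)

open scoped Classical in
/-- The network made of a set of records. -/
noncomputable def World.ofKnown {α : Type} (A : Set (α × NodeRecord α)) : World α := fun a =>
  if h : ∃ r, (a, r) ∈ A then h.choose else ⟨[], 0, fun _ => false⟩

open scoped Classical in
/-- The algorithm that collects all records in the surroundings of a node and then applies `dec`.
The first entry of the seed serves as identifier, the others are compared with `p`. -/
noncomputable def gossip (p : ℕ → ℝ) (dec : World unitInterval → unitInterval → Bool) :
    LocalAlgorithm ℝ≥0 Bool where
  State := GossipState unitInterval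
  Msg := GossipState unitInterval
  init _ w x := ⟨x 0, ⟨[], w, fun i => decide ((x (i + 1) : ℝ) ≤ p i)⟩, ∅⟩
  send _ σ _ := σ
  recv _ σ m := ⟨σ.id, ⟨List.ofFn fun i => (m i).id, σ.record.wt, σ.record.bit⟩,
    {(σ.id, ⟨List.ofFn fun i => (m i).id, σ.record.wt, σ.record.bit⟩)} ∪ ⋃ i, (m i).known⟩
  output σ := dec (World.ofKnown σ.known) σ.id

section Gossip

variable {V : Type} {G : SimpleGraph V} (P : PortNumbering G) (w : V → ℝ≥0) (s : V → Seed)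
  (p : ℕ → ℝ) (dec : World unitInterval → unitInterval → Bool)

/-- The network with given random bits. -/
def PortNumbering.world (bit : V → ℕ → Bool) : World V := fun v =>
  ⟨List.ofFn fun i => (P.port v i : V), w v, bit v⟩

theorem PortNumbering.mem_world_nbr {bit : V → ℕ → Bool} {v u : V} :
    u ∈ (P.world w bit v).nbr ↔ G.Adj v u := by
  simp only [world, List.mem_ofFn]
  constructor
  · rintro ⟨i, rfl⟩
    exact (P.port v i).2
  · intro h
    exact ⟨(P.port v).symm ⟨u, h⟩, by simp⟩

open scoped Classical in
/-- The random bits obtained by comparing the seeds with `p`. -/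
noncomputable def seedBits (v : V) (i : ℕ) : Bool := decide ((s v (i + 1) : ℝ) ≤ p i)

theorem gossip_id (t : ℕ) (v : V) : ((gossip p dec).stateAfter P w s t v).id = s v 0 := by
  induction t with
  | zero => rfl
  | succ t ih => exact ih

theorem gossip_record_wt_bit (t : ℕ) (v : V) :
    ((gossip p dec).stateAfter P w s t v).record.wt = w v ∧
      ((gossip p dec).stateAfter P w s t v).record.bit = seedBits s p v := by
  induction t with
  | zero => exact ⟨rfl, rfl⟩
  | succ t ih => exact ih

theorem gossip_known_succ (t : ℕ) (v : V) :
    ((gossip p dec).stateAfter P w s (t + 1) v).known =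
      {(s v 0, (P.world w (seedBits s p) v).map fun v => s v 0)} ∪
        ⋃ i, ((gossip p dec).stateAfter P w s t (P.port v i)).known := by
  obtain ⟨h1, h2⟩ := gossip_record_wt_bit P w s p dec t v
  have h3 : ∀ u, ((gossip p dec).stateAfter P w s t u).id = s u 0 := gossip_id P w s p dec t
  have : ((gossip p dec).stateAfter P w s (t + 1) v).known =
      {(((gossip p dec).stateAfter P w s t v).id,
        ⟨List.ofFn fun i => ((gossip p dec).stateAfter P w s t (P.port v i)).id,
        ((gossip p dec).stateAfter P w s t v).record.wt,
        ((gossip p dec).stateAfter P w s t v).record.bit⟩)} ∪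
        ⋃ i, ((gossip p dec).stateAfter P w s t (P.port v i)).known := rfl
  rw [this, h1, h2]
  simp only [h3, NodeRecord.map, PortNumbering.world, List.map_ofFn]
  rfl

variable {s} (hs : Function.Injective fun v => s v 0)
include hs

theorem gossip_known_sound (t : ℕ) (v : V) {a : unitInterval} {r : NodeRecord unitInterval}
    (h : (a, r) ∈ ((gossip p dec).stateAfter P w s t v).known) :
    r = (P.world w (seedBits s p)).map (fun v => s v 0) a := by
  induction t generalizing v with
  | zero => exact h.elim
  | succ t ih =>
    rw [gossip_known_succ] at h
    rcases h with h | h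
    · rw [Set.mem_singleton_iff, Prod.mk.injEq] at h
      rw [h.1, h.2]
      exact (World.map_apply hs _ v).symm
    · obtain ⟨i, hi⟩ := Set.mem_iUnion.1 h
      exact ih _ hi

/-- A complete record needs the identifiers of the neighbours, which takes one round; hence radius
`t` after `t + 1` rounds. -/
theorem gossip_known_complete (t : ℕ) (v : V) {a : unitInterval}
    (h : a ∈ ((P.world w (seedBits s p)).map fun v => s v 0).ball t (s v 0)) :
    (a, (P.world w (seedBits s p)).map (fun v => s v 0) a) ∈
      ((gossip p dec).stateAfter P w s (t + 1) v).known := by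
  have self : ∀ v, (s v 0, (P.world w (seedBits s p)).map (fun v => s v 0) (s v 0)) ∈
      ({(s v 0, (P.world w (seedBits s p) v).map fun v => s v 0)} : Set _) := fun v => by
    rw [World.map_apply hs _ v]
    rfl
  induction t generalizing v with
  | zero =>
    obtain rfl : a = s v 0 := h
    rw [gossip_known_succ]
    exact Or.inl (self v)
  | succ t ih =>
    rw [gossip_known_succ]
    rcases h with h | ⟨u, hu, h⟩
    · obtain rfl : a = s v 0 := h
      exact Or.inl (self v)
    · rw [World.map_apply hs _ v] at hu
      simp only [NodeRecord.map, PortNumbering.world, List.map_ofFn, List.mem_ofFn] at hu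
      obtain ⟨i, rfl⟩ := hu
      exact Or.inr (Set.mem_iUnion.2 ⟨i, ih _ h⟩)

theorem gossip_output {R : ℕ}
    (hdec : ∀ W W' : World unitInterval, ∀ v, World.Agree W W' R v → dec W v = dec W' v) (v : V) :
    (gossip p dec).outputAfter P w s (R + 1) v =
      dec ((P.world w (seedBits s p)).map fun v => s v 0) (s v 0) := by
  change dec (World.ofKnown _) _ = _
  rw [gossip_id]
  refine (hdec _ _ _ fun u hu => ?_).symm
  have h : ∃ r, (u, r) ∈ ((gossip p dec).stateAfter P w s (R + 1) v).known :=
    ⟨_, gossip_known_complete P w p dec hs R v hu⟩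
  rw [World.ofKnown, dif_pos h]
  exact (gossip_known_sound P w p dec hs _ _ h.choose_spec).symm

end Gossip

/-! ### From the packing to an approximate cover. -/

open scoped Classical in
/-- The decision to join the cover: the residual weight is at most a `δ` fraction of the weight. -/
noncomputable def coverDecision (levels : ℕ) (K δ : ℝ) (T : ℕ) (W : World unitInterval)
    (a : unitInterval) : Bool :=
  decide ((W.run levels K (1 / (2 * (levels : ℝ) ^ 2)) T).1 a ≤ δ * (W a).wt)

theorem coverDecision_congr {levels T : ℕ} {K δ : ℝ} {W W' : World unitInterval}
    {a : unitInterval} (h : World.Agree W W' (3 * levels * T) a) :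
    coverDecision levels K δ T W a = coverDecision levels K δ T W' a := by
  unfold coverDecision
  rw [(World.run_congr h).1, h.self]

/-- Weak LP duality. Every edge carrying packing value meets `S'`, where loads are at most `w`, so
the total value is at most the weight of `S'`. A node of `S` has load at least `(1 - δ) * w v`, and
each edge is counted at two endpoints. -/
theorem isApproxMinWeightVertexCover_of_packing {V : Type} [Fintype V] {G : SimpleGraph V}
    {w : V → ℝ≥0} {δ ρ : ℝ} (hδ : δ < 1) (hρ : 2 / (1 - δ) ≤ ρ) {S : Finset V} {rem : V → ℝ}
    {Y : V → V → ℝ} (hcover : ∀ v u, G.Adj v u → v ∈ S ∨ u ∈ S)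
    (hS : ∀ v ∈ S, rem v ≤ δ * w v) (hrem : ∀ v, 0 ≤ rem v)
    (hY : ∀ v u, 0 ≤ Y v u) (hYG : ∀ v u, Y v u ≠ 0 → G.Adj v u)
    (hYr : ∀ v, (w v : ℝ) - rem v = ∑ u, (Y v u + Y u v)) :
    IsApproxMinWeightVertexCover G w ρ S := by
  classical
  refine ⟨fun v u h => by simpa using hcover v u h, fun S' hS' => ?_⟩
  have hδ' : 0 < 1 - δ := by linarith
  have h0 : ∀ v, 0 ≤ ∑ u, (Y v u + Y u v) :=
    fun v => Finset.sum_nonneg fun u _ => add_nonneg (hY _ _) (hY _ _)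
  have h1 : (1 - δ) * ∑ v ∈ S, (w v : ℝ) ≤ 2 * ∑ v, ∑ u, Y v u := by
    calc (1 - δ) * ∑ v ∈ S, (w v : ℝ) ≤ ∑ v ∈ S, ∑ u, (Y v u + Y u v) := by
          rw [Finset.mul_sum]
          refine Finset.sum_le_sum fun v hv => ?_
          rw [← hYr]
          linarith [hS v hv]
      _ ≤ ∑ v, ∑ u, (Y v u + Y u v) :=
          Finset.sum_le_sum_of_subset_of_nonneg (Finset.subset_univ _) fun v _ _ => h0 v
      _ = 2 * ∑ v, ∑ u, Y v u := by
          simp only [Finset.sum_add_distrib]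
          rw [Finset.sum_comm (f := fun v u => Y u v)]
          ring
  have h2 : ∑ v, ∑ u, Y v u ≤ ∑ v ∈ S', (w v : ℝ) := by
    calc ∑ v, ∑ u, Y v u
        ≤ ∑ v, ∑ u, ((if v ∈ S' then Y v u else 0) + if u ∈ S' then Y v u else 0) := by
          refine Finset.sum_le_sum fun v _ => Finset.sum_le_sum fun u _ => ?_
          by_cases h : Y v u = 0
          · simp [h]
          · have := hY v u
            rcases hS' (hYG v u h) with h | h
            · rw [if_pos (Finset.mem_coe.1 h)]
              split_ifs <;> linarith
            · rw [if_pos (Finset.mem_coe.1 h)]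
              split_ifs <;> linarith
      _ = ∑ v ∈ S', ∑ u, (Y v u + Y u v) := by
          simp only [Finset.sum_add_distrib]
          rw [Finset.sum_comm (f := fun v u => if u ∈ S' then Y v u else 0)]
          have : ∀ (g : V → V → ℝ), ∑ v, ∑ u, (if v ∈ S' then g v u else 0) =
              ∑ v ∈ S', ∑ u, g v u := fun g => by
            rw [← Finset.sum_filter_add_sum_filter_not Finset.univ (· ∈ S')]
            rw [Finset.sum_eq_zero (s := Finset.univ.filter fun v => ¬ v ∈ S')
              fun v hv => by simp [(Finset.mem_filter.1 hv).2]]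
            rw [add_zero]
            refine Finset.sum_congr (by ext; simp) fun v hv => ?_
            simp [hv]
          rw [this, this fun v u => Y u v]
      _ ≤ ∑ v ∈ S', (w v : ℝ) := by
          refine Finset.sum_le_sum fun v _ => ?_
          rw [← hYr]
          linarith [hrem v]
  have h3 : 0 ≤ ∑ v ∈ S', (w v : ℝ) := Finset.sum_nonneg fun v _ => (w v).2
  calc ∑ v ∈ S, (w v : ℝ) ≤ 2 / (1 - δ) * ∑ v ∈ S', (w v : ℝ) := by
        rw [div_mul_eq_mul_div, le_div_iff₀ hδ']
        linarith
    _ ≤ ρ * ∑ v ∈ S', (w v : ℝ) := mul_le_mul_of_nonneg_right hρ h3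

/-- If the random clustering is successful, the selected nodes form a good vertex cover. -/
theorem selected_gossip_isApprox {V : Type} [Fintype V] {G : SimpleGraph V} (P : PortNumbering G)
    (w : V → ℝ≥0) {s : V → Seed} (hs : Function.Injective fun v => s v 0) (p : ℕ → ℝ)
    {levels T : ℕ} {K ε : ℝ} (hlev : 1 ≤ levels) (hK : 4 ≤ K) (hε : 0 < ε) (hε1 : ε < 1)
    {D : ℕ → ℝ}
    (hD : ∀ i < levels, ∀ v, (P.world w (seedBits s p)).Retired i v →
      (((P.world w (seedBits s p)).bundles i v).card : ℝ) ≤ D i)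
    (hnone : ∀ v, (P.world w (seedBits s p)).center levels v = none)
    (hT : ∀ i < levels, 2 * Real.log (D i) + 4 * K * Real.log (4 / ε) * (2 * (levels : ℝ) ^ 2) *
      ((levels / (i + 1) : ℕ) : ℝ) * Real.log K ≤
        ((levels / (i + 1) : ℕ) : ℝ) * T * Real.log K) :
    IsApproxMinWeightVertexCover G w (2 + ε) (selected
      ((gossip p (coverDecision levels K (ε / 4) T)).outputAfter P w s (3 * levels * T + 1))) := by
  classical
  set W₀ := P.world w (seedBits s p) with hW₀
  set f : V → unitInterval := fun v => s v 0 with hf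
  set W := W₀.map f with hWdef
  set ρ : ℝ := 1 / (2 * (levels : ℝ) ^ 2) with hρdef
  have hlev' : (1 : ℝ) ≤ levels := by exact_mod_cast hlev
  have hρ0 : 0 < ρ := by positivity
  have hρs : 2 * ρ * (levels : ℝ) ^ 2 ≤ 1 := by
    rw [hρdef]
    field_simp
    norm_num
  have hρ1 : ρ ≤ 1 := by nlinarith
  have hmap : ∀ v, W (f v) = (W₀ v).map f := World.map_apply hs W₀
  have hnbr : ∀ v u, f u ∈ (W (f v)).nbr ↔ G.Adj v u := fun v u => by
    rw [hmap, ← P.mem_world_nbr w (bit := seedBits s p)]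
    exact List.mem_map_of_injective hs
  have hmem : ∀ a, ∀ x ∈ (W a).nbr, ∃ v u, a = f v ∧ x = f u := fun a x hx => by
    by_cases ha : ∃ v, f v = a
    · obtain ⟨v, rfl⟩ := ha
      rw [hmap] at hx
      obtain ⟨u, -, rfl⟩ := List.mem_map.1 hx
      exact ⟨v, u, rfl, rfl⟩
    · rw [hWdef, World.map, dif_neg ha] at hx
      simp at hx
  have hW : W.IsNetwork (Finset.univ.image f) := fun a x hx => by
    obtain ⟨v, u, rfl, rfl⟩ := hmem a x hx
    exact ⟨Finset.mem_image_of_mem f (Finset.mem_univ v), (hnbr u v).2 ((hnbr v u).1 hx).symm⟩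
  have hout : ∀ v, v ∈ selected ((gossip p (coverDecision levels K (ε / 4) T)).outputAfter P w s
      (3 * levels * T + 1)) ↔ (W.run levels K ρ T).1 (f v) ≤ ε / 4 * w v := fun v => by
    rw [selected, Finset.mem_filter,
      gossip_output P w p (coverDecision levels K (ε / 4) T) hs
        fun W W' v h => coverDecision_congr h, coverDecision]
    simp only [Finset.mem_univ, true_and, decide_eq_true_eq]
    change (W.run levels K ρ T).1 (f v) ≤ ε / 4 * (W (f v)).wt ↔ _
    rw [hmap]
    rfl
  obtain ⟨Y, hY0, hYn, hYr⟩ :=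
    World.exists_packing hW (by linarith) hρ0.le hρs T (s := levels) (K := K)
  refine isApproxMinWeightVertexCover_of_packing (δ := ε / 4)
    (rem := fun v => (W.run levels K ρ T).1 (f v)) (Y := fun v u => Y (f v) (f u))
    (by linarith) ?_ (fun v u hvu => ?_) (fun v hv => (hout v).1 hv)
    (fun v => World.run_rem_nonneg hW (by linarith) hρ0.le hρs T _) (fun v u => hY0 _ _)
    (fun v u h => (hnbr v u).1 (hYn _ _ h)) fun v => ?_
  · rw [div_le_iff₀ (by linarith)]
    nlinarith
  · rw [hout, hout]
    have := World.run_covers (D := D) (T := T) (δ := ε / 4) hW (by linarith) hρ0.le hρs hρ0 hρ1 hK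
      (by linarith) ?_ ?_ ?_ ((hnbr v u).2 hvu)
    · rw [hmap, hmap] at this
      exact this
    · intro i hi a haU ha
      obtain ⟨v, -, rfl⟩ := Finset.mem_image.1 haU
      exact (Nat.cast_le.2 (World.card_bundles_map hs i v)).trans
        (hD i hi v ((World.retired_map hs).1 ha))
    · intro a ha
      obtain ⟨v, -, rfl⟩ := Finset.mem_image.1 ha
      rw [hWdef, World.center_map hs, hnone, Option.map_none]
    · intro i hi
      have e1 : (1 : ℝ) / (ε / 4) = 4 / ε := by rw [one_div_div]
      have e2 : 4 * K * Real.log (4 / ε) / ρ =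
          4 * K * Real.log (4 / ε) * (2 * (levels : ℝ) ^ 2) := by
        rw [hρdef, div_div_eq_mul_div, div_one]
      rw [e1, e2]
      exact hT i hi
  · have := hYr (f v)
    rw [Finset.sum_image (fun a _ b _ h => hs h)] at this
    rw [← this, hmap]
    rfl

/-! ### Distribution of seeds and random bits. -/

open MeasureTheory ProbabilityTheory

section Seeds

variable {V : Type} [Fintype V]

instance isProbabilityMeasure_seedMeasure : IsProbabilityMeasure (seedMeasure V) := by
  unfold seedMeasure
  infer_instance

theorem measurePreserving_seed (v : V) : MeasurePreserving (fun s : V → Seed => s v)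
    (seedMeasure V) (Measure.infinitePi fun _ : ℕ => (volume : Measure unitInterval)) :=
  measurePreserving_eval _ v

theorem measurePreserving_seed_apply (v : V) (j : ℕ) :
    MeasurePreserving (fun s : V → Seed => s v j) (seedMeasure V) volume :=
  (measurePreserving_eval_infinitePi _ j).comp (measurePreserving_seed v)

theorem iIndepFun_seed :
    iIndepFun (fun (q : V × ℕ) (s : V → Seed) => s q.1 q.2) (seedMeasure V) := by
  refine iIndepFun_uncurry' (X := fun (v : V) (j : ℕ) (s : V → Seed) => s v j)
    (fun v j => (measurePreserving_seed_apply v j).measurable) ?_ fun v => ?_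
  · exact iIndepFun_pi (X := fun (_ : V) (x : Seed) => x) fun v => aemeasurable_id
  · rw [iIndepFun_iff_map_fun_eq_infinitePi_map
      fun j => (measurePreserving_seed_apply v j).measurable]
    simp only [(measurePreserving_seed_apply v _).map_eq]
    exact (measurePreserving_seed v).map_eq

theorem seedMeasure_eq_seed {u v : V} (h : u ≠ v) :
    seedMeasure V {s | s u 0 = s v 0} = 0 := by
  have hind := (iIndepFun_seed (V := V)).indepFun (i := (u, 0)) (j := (v, 0)) (by simpa using h)
  have hu := measurePreserving_seed_apply u 0
  have hv := measurePreserving_seed_apply v 0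
  have hmap := hind.map_prod_eq_prod_map_map hu.measurable.aemeasurable hv.measurable.aemeasurable
  rw [hu.map_eq, hv.map_eq] at hmap
  have hpre : {s : V → Seed | s u 0 = s v 0} =
      (fun s : V → Seed => (s u 0, s v 0)) ⁻¹' Set.diagonal unitInterval := rfl
  rw [hpre, ← Measure.map_apply (hu.measurable.prodMk hv.measurable) measurableSet_diagonal, hmap,
    Measure.measure_prod_null measurableSet_diagonal]
  refine Filter.Eventually.of_forall fun x => ?_
  have : Prod.mk x ⁻¹' Set.diagonal unitInterval = {x} := by
    ext y
    simp [eq_comm]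
  simp [this]

/-- The first seed entries almost surely serve as unique identifiers, because the diagonal is a null
set. -/
theorem seedMeasure_not_injective :
    seedMeasure V {s | ¬ Function.Injective fun v => s v 0} = 0 := by
  refine measure_mono_null (t := ⋃ q : V × V, ⋃ _ : q.1 ≠ q.2, {s | s q.1 0 = s q.2 0})
    (fun s hs => ?_) ?_
  · simp only [Function.Injective, Set.mem_ofPred_eq, not_forall] at hs
    obtain ⟨u, v, huv, hne⟩ := hs
    exact Set.mem_iUnion₂.2 ⟨(u, v), hne, huv⟩
  · exact measure_iUnion_null fun q => measure_iUnion_null fun h => seedMeasure_eq_seed h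

variable {p : ℕ → ℝ}

theorem measurable_decide_le (x : ℝ) :
    Measurable fun y : unitInterval => decide ((y : ℝ) ≤ x) := by
  refine measurable_to_bool ?_
  have : (fun y : unitInterval => decide ((y : ℝ) ≤ x)) ⁻¹' {true} =
      Subtype.val ⁻¹' Set.Iic x := by
    ext
    simp
  rw [this]
  exact measurable_subtype_coe measurableSet_Iic

theorem measurable_seedBits (v : V) (i : ℕ) :
    Measurable fun s : V → Seed => seedBits s p v i := by
  have := (measurable_decide_le (p i)).comp (measurePreserving_seed_apply v (i + 1)).measurable
  convert this
  simp [seedBits]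

theorem iIndepFun_seedBits :
    iIndepFun (fun (q : V × ℕ) (s : V → Seed) => seedBits s p q.1 q.2) (seedMeasure V) := by
  have h := (iIndepFun_seed (V := V)).precomp (g := fun q : V × ℕ => (q.1, q.2 + 1))
    (fun a b hab => by simpa [Prod.ext_iff] using hab)
  have := h.comp (fun q y => decide ((y : ℝ) ≤ p q.2)) fun q => measurable_decide_le (p q.2)
  convert this using 4
  simp [seedBits]

theorem seedMeasure_bit_true (v : V) {i : ℕ} (h0 : 0 ≤ p i) (h1 : p i ≤ 1) :
    seedMeasure V ((fun s => seedBits s p v i) ⁻¹' {true}) = ENNReal.ofReal (p i) := by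
  have hset : (fun s : V → Seed => seedBits s p v i) ⁻¹' {true} =
      (fun s : V → Seed => s v (i + 1)) ⁻¹' Set.Iic (⟨p i, h0, h1⟩ : unitInterval) := by
    ext s
    simp [seedBits, ← Subtype.coe_le_coe]
  rw [hset, (measurePreserving_seed_apply v (i + 1)).measure_preimage
    measurableSet_Iic.nullMeasurableSet, unitInterval.volume_Iic]

theorem seedMeasure_bit_false (v : V) {i : ℕ} (h0 : 0 ≤ p i) (h1 : p i ≤ 1) :
    seedMeasure V ((fun s => seedBits s p v i) ⁻¹' {false}) = ENNReal.ofReal (1 - p i) := by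
  have hset : (fun s : V → Seed => seedBits s p v i) ⁻¹' {false} =
      ((fun s : V → Seed => seedBits s p v i) ⁻¹' {true})ᶜ := by
    ext s
    simp
  rw [hset, prob_compl_eq_one_sub (measurable_seedBits v i (measurableSet_singleton _)),
    seedMeasure_bit_true v h0 h1, ENNReal.ofReal_sub _ h0, ENNReal.ofReal_one]

theorem seedMeasure_forall_bit_true (v : V) (m : ℕ) (hp : ∀ i < m, 0 ≤ p i ∧ p i ≤ 1) :
    seedMeasure V {s | ∀ i < m, seedBits s p v i = true} =
      ENNReal.ofReal (∏ i ∈ Finset.range m, p i) := by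
  have h := (iIndepFun_seedBits (V := V) (p := p)).precomp (g := fun i : ℕ => (v, i))
    fun a b hab => by simpa using hab
  have h2 := h.measure_inter_preimage_eq_mul (Finset.range m) (sets := fun _ => {true})
    fun i _ => measurableSet_singleton _
  rw [ENNReal.ofReal_prod_of_nonneg fun i hi => (hp i (Finset.mem_range.1 hi)).1]
  rw [Finset.prod_congr rfl fun i hi => seedMeasure_bit_true v (hp i (Finset.mem_range.1 hi)).1
    (hp i (Finset.mem_range.1 hi)).2] at h2
  rw [← h2]
  congr 1
  ext s
  simp

theorem seedMeasure_forall_bit_false (B : Finset V) {i : ℕ} (h0 : 0 ≤ p i) (h1 : p i ≤ 1) :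
    seedMeasure V {s | ∀ b ∈ B, seedBits s p b i = false} =
      ENNReal.ofReal (1 - p i) ^ B.card := by
  have h := (iIndepFun_seedBits (V := V) (p := p)).precomp (g := fun b : V => (b, i))
    fun a b hab => by simpa using hab
  have h2 := h.measure_inter_preimage_eq_mul B (sets := fun _ => {false})
    fun i _ => measurableSet_singleton _
  rw [Finset.prod_congr rfl fun b _ => seedMeasure_bit_false b h0 h1, Finset.prod_const] at h2
  rw [← h2]
  congr 1
  ext s
  simp

end Seeds

/-! ### Probability that the clustering fails. -/

section Clustering

variable {V : Type} {G : SimpleGraph V} (P : PortNumbering G) (w : V → ℝ≥0)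

theorem center_world_congr {bit bit' : V → ℕ → Bool} {i : ℕ}
    (h : ∀ v, ∀ j < i, bit v j = bit' v j) (v : V) :
    (P.world w bit).center i v = (P.world w bit').center i v := by
  induction i generalizing v with
  | zero => rfl
  | succ i ih =>
    have ih' : (P.world w bit).center i = (P.world w bit').center i :=
      funext fun v => ih (fun v j hj => h v j (hj.trans (Nat.lt_succ_self i))) v
    have hb : ∀ b, (P.world w bit b).bit i = (P.world w bit' b).bit i :=
      fun b => h b i (Nat.lt_succ_self i)
    simp only [World.center, hb, ih']
    rfl

/-- The bundles at level `i` depend only on bits of lower levels, hence are independent of the bits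
that decide survival at level `i`. -/
theorem bundles_world_congr {bit bit' : V → ℕ → Bool} {i : ℕ}
    (h : ∀ v, ∀ j < i, bit v j = bit' v j) (v : V) :
    (P.world w bit).bundles i v = (P.world w bit').bundles i v := by
  have : (P.world w bit).center i = (P.world w bit').center i :=
    funext fun v => center_world_congr P w h v
  unfold World.bundles
  rw [this]
  rfl

variable [Fintype V] {p : ℕ → ℝ}

/-- It is unlikely that many clusters are adjacent to `v` but none of them survives. -/
theorem seedMeasure_retired_le (v : V) {i : ℕ} (h0 : 0 ≤ p i) (h1 : p i ≤ 1) {D : ℝ} :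
    seedMeasure V {s | (P.world w (seedBits s p)).Retired i v ∧
        D < ((P.world w (seedBits s p)).bundles i v).card} ≤
      ENNReal.ofReal (Real.exp (-(p i * D))) := by
  classical
  set bund : (V → Seed) → Finset V := fun s => (P.world w (seedBits s p)).bundles i v with hbund
  have hprod : ∀ B : Finset V,
      seedMeasure V ({s | bund s = B} ∩ {s | ∀ b ∈ B, seedBits s p b i = false}) =
        seedMeasure V {s | bund s = B} * ENNReal.ofReal (1 - p i) ^ B.card ∧
      MeasurableSet {s | bund s = B} := by
    intro B
    set S : Finset (V × ℕ) := Finset.univ ×ˢ Finset.range i with hS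
    set T : Finset (V × ℕ) := Finset.univ ×ˢ {i} with hT
    have hST : Disjoint S T := by
      rw [Finset.disjoint_left]
      rintro ⟨a, j⟩ h h'
      simp only [hS, hT, Finset.mem_product, Finset.mem_univ, true_and, Finset.mem_range,
        Finset.mem_singleton] at h h'
      omega
    have hind := (iIndepFun_seedBits (V := V) (p := p)).indepFun_finset S T hST
      fun q => measurable_seedBits q.1 q.2
    have hmem : ∀ b : V, (b, i) ∈ T := fun b => by simp [hT]
    -- Bits outside `S` get the irrelevant default `false`.
    set M : Set (S → Bool) := {x | (P.world w fun a j =>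
      if h : (a, j) ∈ S then x ⟨(a, j), h⟩ else false).bundles i v = B} with hM
    set N : Set (T → Bool) := {y | ∀ b ∈ B, y ⟨(b, i), hmem b⟩ = false} with hN
    have hMeas : MeasurableSet M := MeasurableSet.of_discrete
    have e1 : {s | bund s = B} =
        (fun (s : V → Seed) (q : S) => seedBits s p q.1.1 q.1.2) ⁻¹' M := by
      ext s
      simp only [hM, Set.mem_ofPred_eq, Set.mem_preimage, hbund]
      rw [bundles_world_congr P w (bit := seedBits s p)]
      intro a j hj
      have : (a, j) ∈ S := by simp [hS, hj]
      rw [dif_pos this]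
    have e2 : {s | ∀ b ∈ B, seedBits s p b i = false} =
        (fun (s : V → Seed) (q : T) => seedBits s p q.1.1 q.1.2) ⁻¹' N := rfl
    refine ⟨?_, ?_⟩
    · rw [← seedMeasure_forall_bit_false B h0 h1, e1, e2]
      exact hind.measure_inter_preimage_eq_mul M N hMeas MeasurableSet.of_discrete
    · rw [e1]
      exact (measurable_pi_lambda _ fun q => measurable_seedBits q.1.1 q.1.2) hMeas
  -- Condition on the value `B` of the bundle set: all its centers must fail, which has probability
  -- `(1 - p i) ^ B.card ≤ exp (-(p i * D))`.
  calc _ ≤ seedMeasure V (⋃ B ∈ (Finset.univ : Finset (Finset V)).filter fun B => D < B.card,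
          ({s | bund s = B} ∩ {s | ∀ b ∈ B, seedBits s p b i = false})) := by
        refine measure_mono fun s hs => ?_
        simp only [Set.mem_iUnion]
        exact ⟨bund s, Finset.mem_filter.2 ⟨Finset.mem_univ _, hs.2⟩, rfl,
          fun b hb => hs.1.bit_eq_false hb⟩
    _ ≤ ∑ B ∈ (Finset.univ : Finset (Finset V)).filter fun B => D < B.card,
          seedMeasure V ({s | bund s = B} ∩ {s | ∀ b ∈ B, seedBits s p b i = false}) :=
        measure_biUnion_finset_le _ _
    _ ≤ ∑ B ∈ (Finset.univ : Finset (Finset V)).filter fun B => D < B.card,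
          seedMeasure V {s | bund s = B} * ENNReal.ofReal (Real.exp (-(p i * D))) := by
        refine Finset.sum_le_sum fun B hB => ?_
        rw [(hprod B).1]
        gcongr
        rw [← ENNReal.ofReal_pow (by linarith)]
        refine ENNReal.ofReal_le_ofReal ?_
        calc (1 - p i) ^ B.card ≤ Real.exp (-p i) ^ B.card :=
              pow_le_pow_left₀ (by linarith) (Real.one_sub_le_exp_neg _) _
          _ = Real.exp (-(p i * B.card)) := by rw [← Real.exp_nat_mul]; ring_nf
          _ ≤ _ := by
              have := (Finset.mem_filter.1 hB).2
              refine Real.exp_le_exp.2 (neg_le_neg (mul_le_mul_of_nonneg_left this.le h0))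
    _ = seedMeasure V (⋃ B ∈ (Finset.univ : Finset (Finset V)).filter fun B => D < B.card,
          {s | bund s = B}) * ENNReal.ofReal (Real.exp (-(p i * D))) := by
        rw [← Finset.sum_mul, measure_biUnion_finset _ fun B _ => (hprod B).2]
        intro B _ B' _ hne
        refine Set.disjoint_left.2 fun s hs hs' => hne ?_
        exact (show bund s = B from hs).symm.trans hs'
    _ ≤ 1 * ENNReal.ofReal (Real.exp (-(p i * D))) := by
        gcongr
        exact prob_le_one
    _ = _ := one_mul _

/-- The last level is probably empty. -/
theorem seedMeasure_center_le (m : ℕ) (hp : ∀ i < m, 0 ≤ p i ∧ p i ≤ 1) :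
    seedMeasure V {s | ∃ v, (P.world w (seedBits s p)).center m v ≠ none} ≤
      Fintype.card V * ENNReal.ofReal (∏ i ∈ Finset.range m, p i) := by
  calc _ ≤ seedMeasure V (⋃ b ∈ (Finset.univ : Finset V),
          {s | ∀ i < m, seedBits s p b i = true}) := by
        refine measure_mono fun s hs => ?_
        obtain ⟨v, hv⟩ := hs
        obtain ⟨b, hb⟩ := Option.ne_none_iff_exists'.1 hv
        simp only [Set.mem_iUnion]
        exact ⟨b, Finset.mem_univ b, World.bit_of_center hb⟩
    _ ≤ ∑ b ∈ (Finset.univ : Finset V), seedMeasure V {s | ∀ i < m, seedBits s p b i = true} :=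
        measure_biUnion_finset_le _ _
    _ = _ := by
        simp only [seedMeasure_forall_bit_true _ m hp]
        rw [Finset.sum_const, nsmul_eq_mul, Finset.card_univ]

end Clustering

/-! ### Choice of parameters and the running time. -/

/-- The probability with which the clusters of level `i` survive. -/
noncomputable def survival (n m : ℕ) (i : ℕ) : ℝ :=
  Real.exp (-(3 * Real.log n / ((i + 1) * (harmonic m : ℝ))))

/-- A bound for the number of clusters adjacent to a node that retires at level `i`. -/
noncomputable def bundleBound (n m : ℕ) (i : ℕ) : ℝ := 4 * Real.log n / survival n m i

theorem harmonic_real_pos {m : ℕ} (hm : 1 ≤ m) : (0 : ℝ) < (harmonic m : ℝ) := by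
  exact_mod_cast harmonic_pos (by omega)

theorem prod_survival {n m : ℕ} (hn : 1 ≤ n) (hm : 1 ≤ m) :
    ∏ i ∈ Finset.range m, survival n m i = ((n : ℝ) ^ 3)⁻¹ := by
  have hH := harmonic_real_pos hm
  have hn' : (0 : ℝ) < n := by exact_mod_cast hn
  unfold survival
  rw [← Real.exp_sum]
  have : ∑ i ∈ Finset.range m, -(3 * Real.log n / (((i : ℕ) + 1) * (harmonic m : ℝ))) =
      -(3 * Real.log n) := by
    have h1 : ∀ i ∈ Finset.range m, -(3 * Real.log n / (((i : ℕ) + 1) * (harmonic m : ℝ))) =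
        -(3 * Real.log n / (harmonic m : ℝ)) * ((i : ℝ) + 1)⁻¹ := fun i _ => by
      field_simp
    rw [Finset.sum_congr rfl h1, ← Finset.mul_sum]
    have h2 : ∑ i ∈ Finset.range m, ((i : ℝ) + 1)⁻¹ = (harmonic m : ℝ) := by
      simp [harmonic]
    rw [h2]
    field_simp
  rw [this, Real.exp_neg, show 3 * Real.log n = Real.log ((n : ℝ) ^ 3) by rw [Real.log_pow]; norm_num,
    Real.exp_log (by positivity)]

theorem survival_mem {n m : ℕ} (i : ℕ) (hn : 1 ≤ n) (hm : 1 ≤ m) :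
    0 ≤ survival n m i ∧ survival n m i ≤ 1 := by
  have hH := harmonic_real_pos hm
  have hn' : 0 ≤ Real.log n := Real.log_nonneg (by exact_mod_cast hn)
  refine ⟨(Real.exp_pos _).le, ?_⟩
  unfold survival
  rw [Real.exp_le_one_iff, neg_nonpos]
  positivity

/-- The selected nodes form a good vertex cover with high probability. -/
theorem seedMeasure_failure_le {n : ℕ} (hn : 2 ≤ n) {levels T : ℕ} {K ε : ℝ} (hlev : 1 ≤ levels)
    (hlevn : levels ≤ n) (hK : 4 ≤ K) (hε : 0 < ε) (hε1 : ε < 1)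
    (hT : ∀ i < levels, 2 * Real.log (bundleBound n levels i) + 4 * K * Real.log (4 / ε) *
      (2 * (levels : ℝ) ^ 2) * ((levels / (i + 1) : ℕ) : ℝ) * Real.log K ≤
        ((levels / (i + 1) : ℕ) : ℝ) * T * Real.log K)
    {V : Type} [Fintype V] (hV : Fintype.card V = n) {G : SimpleGraph V} (P : PortNumbering G)
    (w : V → ℝ≥0) :
    seedMeasure V {s | ¬ IsApproxMinWeightVertexCover G w (2 + ε)
      (selected ((gossip (survival n levels) (coverDecision levels K (ε / 4) T)).outputAfter P w s
        (3 * levels * T + 1)))} ≤ ENNReal.ofReal ((n : ℝ) ^ (-1 : ℝ)) := by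
  classical
  set p := survival n levels with hp
  set D := bundleBound n levels with hDdef
  have hn0 : (2 : ℝ) ≤ n := by exact_mod_cast hn
  have hn1 : 1 ≤ n := by omega
  have hpD : ∀ i, p i * D i = 4 * Real.log n := fun i => by
    have : survival n levels i ≠ 0 := (Real.exp_pos _).ne'
    simp only [hp, hDdef, bundleBound]
    field_simp
  set A : Set (V → Seed) := {s | ¬ Function.Injective fun v => s v 0} with hA
  set B : ℕ × V → Set (V → Seed) := fun q => {s |
    (P.world w (seedBits s p)).Retired q.1 q.2 ∧
      D q.1 < ((P.world w (seedBits s p)).bundles q.1 q.2).card} with hB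
  set E : Set (V → Seed) := {s | ∃ v, (P.world w (seedBits s p)).center levels v ≠ none} with hE
  set Q : Finset (ℕ × V) := Finset.range levels ×ˢ Finset.univ with hQ
  -- At most `n * n` pairs of level and node, each failing with probability at most `exp (-4 log
  -- n)`.
  have hBle : seedMeasure V (⋃ q ∈ Q, B q) ≤ ENNReal.ofReal ((n : ℝ) ^ 2)⁻¹ := by
    calc seedMeasure V (⋃ q ∈ Q, B q) ≤ ∑ q ∈ Q, seedMeasure V (B q) :=
          measure_biUnion_finset_le _ _
      _ ≤ ∑ q ∈ Q, ENNReal.ofReal (((n : ℝ) ^ 4)⁻¹) := by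
          refine Finset.sum_le_sum fun q _ => ?_
          have hpq := survival_mem (n := n) (m := levels) q.1 hn1 hlev
          refine (seedMeasure_retired_le P w q.2 hpq.1 hpq.2 (D := D q.1)).trans_eq ?_
          rw [hpD, Real.exp_neg, show 4 * Real.log n = Real.log ((n : ℝ) ^ 4) by
            rw [Real.log_pow]; norm_num, Real.exp_log (by positivity)]
      _ = ENNReal.ofReal ((levels * n : ℝ) * ((n : ℝ) ^ 4)⁻¹) := by
          rw [Finset.sum_const, hQ, Finset.card_product, Finset.card_range, Finset.card_univ, hV,
            ENNReal.ofReal_mul (by positivity), nsmul_eq_mul]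
          congr 1
          rw [← Nat.cast_mul, ENNReal.ofReal_natCast]
      _ ≤ ENNReal.ofReal ((n : ℝ) ^ 2)⁻¹ := by
          refine ENNReal.ofReal_le_ofReal ?_
          have : (levels : ℝ) ≤ n := by exact_mod_cast hlevn
          calc (levels * n : ℝ) * ((n : ℝ) ^ 4)⁻¹ ≤ (n * n : ℝ) * ((n : ℝ) ^ 4)⁻¹ := by gcongr
            _ = _ := by field_simp
  have hEle : seedMeasure V E ≤ ENNReal.ofReal ((n : ℝ) ^ 2)⁻¹ := by
    refine (seedMeasure_center_le P w levels fun i _ => survival_mem i hn1 hlev).trans_eq ?_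
    rw [prod_survival hn1 hlev, hV, ← ENNReal.ofReal_natCast, ← ENNReal.ofReal_mul (by positivity)]
    congr 1
    field_simp
  calc _ ≤ seedMeasure V (A ∪ ((⋃ q ∈ Q, B q) ∪ E)) := by
        refine measure_mono fun s hs => ?_
        by_contra hnot
        simp only [Set.mem_union, not_or] at hnot
        obtain ⟨hsA, hsB, hsE⟩ := hnot
        refine hs (selected_gossip_isApprox P w (not_not.1 hsA) p hlev hK hε hε1 (D := D)
          (fun i hi v hv => ?_) (fun v => ?_) hT)
        · by_contra hlt
          exact hsB (Set.mem_iUnion₂.2 ⟨(i, v), Finset.mem_product.2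
            ⟨Finset.mem_range.2 hi, Finset.mem_univ v⟩, hv, not_le.1 hlt⟩)
        · by_contra hne
          exact hsE ⟨v, hne⟩
    _ ≤ 0 + (ENNReal.ofReal ((n : ℝ) ^ 2)⁻¹ + ENNReal.ofReal ((n : ℝ) ^ 2)⁻¹) :=
        (measure_union_le _ _).trans (add_le_add seedMeasure_not_injective.le
          ((measure_union_le _ _).trans (add_le_add hBle hEle)))
    _ ≤ ENNReal.ofReal ((n : ℝ) ^ (-1 : ℝ)) := by
        rw [zero_add, ← ENNReal.ofReal_add (by positivity) (by positivity)]
        refine ENNReal.ofReal_le_ofReal ?_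
        rw [Real.rpow_neg_one]
        have hnpos : (0 : ℝ) < n := by linarith
        rw [← two_mul, ← div_eq_mul_inv, inv_eq_one_div, div_le_div_iff₀ (by positivity) hnpos]
        nlinarith

/-- A number of epochs that suffices. -/
theorem epochs_suffice {n : ℕ} {levels : ℕ} {K l : ℝ} {T : ℕ} (hlev : 1 ≤ levels)
    (hK : 1 < K) (hn : 1 ≤ Real.log n)
    (hT : 4 / (levels * Real.log K) *
        (levels * Real.log (4 * Real.log n) + 3 * Real.log n / (harmonic levels : ℝ)) +
      8 * K * l * (levels : ℝ) ^ 2 ≤ T) :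
    ∀ i < levels, 2 * Real.log (bundleBound n levels i) + 4 * K * l *
      (2 * (levels : ℝ) ^ 2) * ((levels / (i + 1) : ℕ) : ℝ) * Real.log K ≤
        ((levels / (i + 1) : ℕ) : ℝ) * T * Real.log K := by
  intro i hi
  have hH := harmonic_real_pos hlev
  have hlK : 0 < Real.log K := Real.log_pos hK
  have hs : (0 : ℝ) < levels := by exact_mod_cast hlev
  have hi1 : (i : ℝ) + 1 ≤ levels := by exact_mod_cast hi
  have hq1 : 1 ≤ levels / (i + 1) := Nat.div_pos hi (Nat.succ_pos i)
  -- Rounding down the positive quotient loses at most a factor of two.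
  have hq : (levels : ℝ) ≤ 2 * ((i : ℝ) + 1) * ((levels / (i + 1) : ℕ) : ℝ) := by
    have h1 : levels < (levels / (i + 1) + 1) * (i + 1) := by
      have := Nat.div_add_mod levels (i + 1)
      have := Nat.mod_lt levels (Nat.succ_pos i)
      nlinarith
    have h2 : levels ≤ 2 * (i + 1) * (levels / (i + 1)) := by nlinarith
    exact_mod_cast h2
  set q : ℝ := ((levels / (i + 1) : ℕ) : ℝ)
  have hq0 : 0 < q := by
    by_contra h
    have : 2 * ((i : ℝ) + 1) * q ≤ 0 :=
      mul_nonpos_of_nonneg_of_nonpos (by positivity) (not_lt.1 h)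
    linarith
  have hlog : Real.log (bundleBound n levels i) =
      Real.log (4 * Real.log n) + 3 * Real.log n / ((i + 1) * (harmonic levels : ℝ)) := by
    rw [bundleBound, survival, Real.log_div (by positivity) (Real.exp_pos _).ne', Real.log_exp,
      sub_neg_eq_add]
  set X := levels * Real.log (4 * Real.log n) + 3 * Real.log n / (harmonic levels : ℝ) with hX
  have hL : 0 ≤ Real.log (4 * Real.log n) := Real.log_nonneg (by linarith)
  -- The factor `i + 1` cancels in `log (1 / p i)`, so one bound `X` serves all levels.
  have hle : ((i : ℝ) + 1) * Real.log (bundleBound n levels i) ≤ X := by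
    rw [hlog, mul_add, hX]
    refine add_le_add (mul_le_mul_of_nonneg_right hi1 hL) (le_of_eq ?_)
    field_simp
  have hX0 : 0 ≤ X := by positivity
  have h1 : 2 * Real.log (bundleBound n levels i) ≤ q * (4 / levels * X) := by
    have e1 : levels * (((i : ℝ) + 1) * Real.log (bundleBound n levels i)) ≤
        2 * ((i : ℝ) + 1) * q * X :=
      (mul_le_mul_of_nonneg_left hle hs.le).trans (mul_le_mul_of_nonneg_right hq hX0)
    have e2 : levels * Real.log (bundleBound n levels i) ≤ 2 * q * X := by
      have : (0 : ℝ) < (i : ℝ) + 1 := by positivity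
      refine le_of_mul_le_mul_left ?_ this
      linarith
    rw [show q * (4 / levels * X) = 2 * ((2 * q * X) / levels) by ring]
    refine mul_le_mul_of_nonneg_left ?_ (by norm_num)
    rw [le_div_iff₀ hs]
    linarith
  have h2 := mul_le_mul_of_nonneg_left hT (mul_nonneg hq0.le hlK.le)
  have h3 : q * Real.log K * (4 / (levels * Real.log K) * X + 8 * K * l * (levels : ℝ) ^ 2) =
      q * (4 / levels * X) + 4 * K * l * (2 * (levels : ℝ) ^ 2) * q * Real.log K := by
    field_simp
    ring
  linarith

/-- For a suitable choice of the parameters the algorithm is as fast as claimed. -/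
theorem exists_parameters {n : ℕ} (hn : 20 ≤ Real.log (Real.log n)) {ε : ℝ} (hε : 0 < ε)
    (hε1 : ε < 1) : ∃ (levels : ℕ) (K : ℝ) (T : ℕ), 1 ≤ levels ∧ levels ≤ n ∧ 4 ≤ K ∧
      4 / (levels * Real.log K) *
          (levels * Real.log (4 * Real.log n) + 3 * Real.log n / (harmonic levels : ℝ)) +
        8 * K * Real.log (4 / ε) * (levels : ℝ) ^ 2 ≤ T ∧
      ((3 * levels * T + 1 : ℕ) : ℝ) ≤ 11000000 * (Real.log n / Real.log (Real.log n) ^ 2 +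
        Real.log n * Real.log (1 / ε) / Real.log (Real.log n) ^ 3) := by
  set N := Real.log n with hN
  set ℓ := Real.log N with hℓ
  -- `b` is `(log n) ^ (1 / 30)`. For moderate `ε` both `K` and the number of levels are about `b ^
  -- 3`; then `log K` and the harmonic number are both at least `ℓ / 10`, while `K * log (4 / ε) * m
  -- ^ 3` is only `O(b ^ 15)`.
  set b := Real.exp (ℓ / 30) with hb
  have hN0 : 0 < N := by
    by_contra h
    have h' : 0 ≤ N := Real.log_natCast_nonneg n
    have : N = 0 := le_antisymm (not_lt.1 h) h'
    rw [hℓ, this, Real.log_zero] at hn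
    linarith
  have hNb : N = b ^ 30 := by
    rw [hb, ← Real.exp_nat_mul, ← Real.exp_log hN0]
    congr 1
    push_cast
    ring
  have hbl : ℓ ≤ 30 * b := by
    have := Real.add_one_le_exp (ℓ / 30)
    linarith
  have hb0 : 0 < b := Real.exp_pos _
  have ha4 : 4 ≤ b ^ 3 := by
    have h1 : b ^ 3 = Real.exp (ℓ / 10) := by
      rw [hb, ← Real.exp_nat_mul]
      congr 1
      push_cast
      ring
    have h2 := Real.quadratic_le_exp_of_nonneg (x := ℓ / 10) (by positivity)
    rw [h1]
    nlinarith
  have hb1 : 1 ≤ b := by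
    by_contra h
    have : b ^ 3 < 1 := pow_lt_one₀ hb0.le (not_le.1 h) (by norm_num)
    linarith
  have hℓ0 : 0 < ℓ := by linarith
  have hNn : N ≤ n := (Real.log_le_self (Nat.cast_nonneg n))
  have hln4 : Real.log 4 ≤ 2 := by
    rw [show (4 : ℝ) = 2 ^ 2 by norm_num, Real.log_pow]
    have := Real.log_two_lt_d9
    push_cast
    linarith
  have hL : Real.log (4 * N) ≤ 2 + ℓ := by
    rw [Real.log_mul (by norm_num) hN0.ne']
    linarith
  have hl : Real.log (4 / ε) ≤ 2 + Real.log (1 / ε) := by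
    rw [show 4 / ε = 4 * (1 / ε) by ring, Real.log_mul (by norm_num) (by positivity)]
    linarith
  have hl0 : 0 ≤ Real.log (4 / ε) := Real.log_nonneg (by rw [le_div_iff₀ hε]; linarith)
  set Λ := Real.log (1 / ε) with hΛ
  have hΛ0 : 0 ≤ Λ := Real.log_nonneg (by rw [le_div_iff₀ hε]; linarith)
  have hL0 : 0 ≤ Real.log (4 * N) := by
    rw [Real.log_mul (by norm_num) hN0.ne']
    have : 0 ≤ Real.log 4 := Real.log_nonneg (by norm_num)
    linarith
  -- the number of rounds for given parameters
  have hrounds : ∀ (m : ℕ) (K : ℝ), 1 ≤ m → 4 ≤ K →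
      ((3 * m * ⌈4 / (m * Real.log K) * (m * Real.log (4 * N) + 3 * N / (harmonic m : ℝ)) +
        8 * K * Real.log (4 / ε) * (m : ℝ) ^ 2⌉₊ + 1 : ℕ) : ℝ) ≤
      12 / Real.log K * (m * Real.log (4 * N) + 3 * N / (harmonic m : ℝ)) +
        24 * K * Real.log (4 / ε) * (m : ℝ) ^ 3 + 3 * m + 1 := by
    intro m K hm hK
    have hH := harmonic_real_pos hm
    have hm0 : (0 : ℝ) < m := by exact_mod_cast hm
    have hlK : 0 < Real.log K := Real.log_pos (by linarith)
    set Z := 4 / (m * Real.log K) * (m * Real.log (4 * N) + 3 * N / (harmonic m : ℝ)) +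
        8 * K * Real.log (4 / ε) * (m : ℝ) ^ 2 with hZ
    have hZ0 : 0 ≤ Z := by positivity
    have h1 := (Nat.ceil_lt_add_one hZ0).le
    push_cast
    calc 3 * (m : ℝ) * (⌈Z⌉₊ : ℝ) + 1 ≤ 3 * (m : ℝ) * (Z + 1) + 1 := by gcongr
      _ = _ := by
        rw [hZ]
        field_simp
        ring
  by_cases hcase : Λ ≤ b ^ 3
  · -- constant or moderately small `ε`
    set m := ⌈b ^ 3⌉₊ with hm
    have hm_le : (m : ℝ) ≤ 2 * b ^ 3 := by
      have := (Nat.ceil_lt_add_one (show 0 ≤ b ^ 3 by positivity)).le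
      linarith
    have hm_ge : b ^ 3 ≤ m := Nat.le_ceil _
    have hm1 : 1 ≤ m := Nat.one_le_ceil_iff.2 (by positivity)
    have hlogb : Real.log (b ^ 3) = ℓ / 10 := by
      rw [Real.log_pow, hb, Real.log_exp]
      push_cast
      ring
    have hH : ℓ / 10 ≤ (harmonic m : ℝ) := by
      rw [← hlogb]
      refine le_trans (Real.log_le_log (by positivity) ?_) (log_add_one_le_harmonic m)
      push_cast
      linarith
    refine ⟨m, b ^ 3, _, hm1, ?_, ha4, Nat.le_ceil _, (hrounds m (b ^ 3) hm1 ha4).trans ?_⟩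
    · have h1 : (m : ℝ) ≤ n := by
        refine hm_le.trans (le_trans ?_ hNn)
        rw [hNb]
        calc 2 * b ^ 3 ≤ b ^ 3 * b ^ 3 := by nlinarith
          _ = b ^ 6 := by ring
          _ ≤ b ^ 30 := pow_le_pow_right₀ hb1 (by norm_num)
      exact_mod_cast h1
    · rw [hlogb]
      have hb15 : b ^ 15 ≤ 900 * (N / ℓ ^ 2) := by
        rw [← mul_div_assoc, le_div_iff₀ (by positivity), hNb]
        have h2 : ℓ ^ 2 ≤ (30 * b) ^ 2 := pow_le_pow_left₀ hℓ0.le hbl 2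
        calc b ^ 15 * ℓ ^ 2 ≤ b ^ 15 * (30 * b) ^ 2 := by gcongr
          _ = 900 * b ^ 17 := by ring
          _ ≤ 900 * b ^ 30 := by
            have := pow_le_pow_right₀ hb1 (show 17 ≤ 30 by norm_num)
            linarith
      have hb3 : b ^ 3 ≤ b ^ 15 := pow_le_pow_right₀ hb1 (by norm_num)
      have t1 : 12 / (ℓ / 10) * (m * Real.log (4 * N) + 3 * N / (harmonic m : ℝ)) ≤
          480 * b ^ 3 + 3600 * (N / ℓ ^ 2) := by
        have h2 : 3 * N / (harmonic m : ℝ) ≤ 3 * N / (ℓ / 10) :=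
          div_le_div_of_nonneg_left (by positivity) (by positivity) hH
        have h3 : m * Real.log (4 * N) ≤ 2 * b ^ 3 * (2 * ℓ) :=
          mul_le_mul hm_le (by linarith) hL0 (by positivity)
        calc 12 / (ℓ / 10) * (m * Real.log (4 * N) + 3 * N / (harmonic m : ℝ)) ≤
            12 / (ℓ / 10) * (2 * b ^ 3 * (2 * ℓ) + 3 * N / (ℓ / 10)) := by gcongr
          _ = _ := by
            field_simp
            ring
      have t2 : 24 * b ^ 3 * Real.log (4 / ε) * (m : ℝ) ^ 3 ≤ 384 * b ^ 15 := by
        have h2 : Real.log (4 / ε) ≤ 2 * b ^ 3 := by linarith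
        calc 24 * b ^ 3 * Real.log (4 / ε) * (m : ℝ) ^ 3 ≤
            24 * b ^ 3 * (2 * b ^ 3) * (2 * b ^ 3) ^ 3 := by gcongr
          _ = _ := by ring
      have t3 : 0 ≤ N * Λ / ℓ ^ 3 := by positivity
      have t4 : 0 ≤ N / ℓ ^ 2 := by positivity
      linarith
  · -- very small `ε`
    have hΛb : b ^ 3 < Λ := not_le.1 hcase
    have hn1 : 1 ≤ n := by
      by_contra h
      have : n = 0 := by omega
      rw [hN, this, Nat.cast_zero, Real.log_zero] at hN0
      exact lt_irrefl _ hN0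
    -- With one level and `K = 4` the cost is `O(N + Λ)`. Since `Λ` exceeds `b ^ 3`, which is at
    -- least `ℓ ^ 3 / 27000`, the second term of the claimed bound dominates both summands.
    refine ⟨1, 4, _, le_rfl, hn1, le_rfl, Nat.le_ceil _, (hrounds 1 4 le_rfl le_rfl).trans ?_⟩
    have hlog4 : 1 ≤ Real.log 4 := by
      rw [show (4 : ℝ) = 2 ^ 2 by norm_num, Real.log_pow]
      have := Real.log_two_gt_d9
      push_cast
      linarith
    have hH1 : ((harmonic 1 : ℚ) : ℝ) = 1 := by simp [harmonic]
    have h12 : 12 / Real.log 4 ≤ 12 := div_le_self (by norm_num) hlog4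
    have hℓN : ℓ ≤ N := Real.log_le_self hN0.le
    rw [hH1]
    push_cast
    have h1 : 12 / Real.log 4 * (1 * Real.log (4 * N) + 3 * N / 1) ≤ 12 * (5 * N) :=
      mul_le_mul h12 (by linarith) (by positivity) (by norm_num)
    have hℓ3 : ℓ ^ 3 ≤ 27000 * b ^ 3 := by
      have := pow_le_pow_left₀ hℓ0.le hbl 3
      calc ℓ ^ 3 ≤ (30 * b) ^ 3 := this
        _ = _ := by ring
    have hb3N : b ^ 3 ≤ N := by
      rw [hNb]
      exact pow_le_pow_right₀ hb1 (by norm_num)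
    have hM1 : N ≤ 27000 * (N * Λ / ℓ ^ 3) := by
      rw [← mul_div_assoc, le_div_iff₀ (by positivity)]
      nlinarith
    have hM2 : Λ ≤ 27000 * (N * Λ / ℓ ^ 3) := by
      rw [← mul_div_assoc, le_div_iff₀ (by positivity)]
      nlinarith
    have t4 : 0 ≤ N / ℓ ^ 2 := by positivity
    linarith

theorem theorem2 :
    ∃ (c : ℝ) (C : ℝ) (n₀ : ℕ) (A : ℕ → ℝ → LocalAlgorithm ℝ≥0 Bool) (T : ℕ → ℝ → ℕ),
      1 ≤ c ∧ 0 < C ∧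
      ∀ n : ℕ, n₀ ≤ n → ∀ ε : ℝ, 0 < ε → ε < 1 →
        (T n ε : ℝ) ≤
            C * (Real.log n / Real.log (Real.log n) ^ 2 +
              Real.log n * Real.log (1 / ε) / Real.log (Real.log n) ^ 3) ∧
        ∀ (V : Type) [Fintype V], Fintype.card V = n →
          ∀ (G : SimpleGraph V) (P : PortNumbering G) (w : V → ℝ≥0),
            seedMeasure V
                {s | ¬ IsApproxMinWeightVertexCover G w (2 + ε)
                    (selected ((A n ε).outputAfter P w s (T n ε)))} ≤
              ENNReal.ofReal ((n : ℝ) ^ (-c)) := by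
  have hlim : Filter.Tendsto (fun n : ℕ => Real.log (Real.log n)) Filter.atTop Filter.atTop :=
    Real.tendsto_log_atTop.comp (Real.tendsto_log_atTop.comp tendsto_natCast_atTop_atTop)
  obtain ⟨n₀, hn₀⟩ := Filter.eventually_atTop.1 (hlim.eventually_ge_atTop 20)
  have hpar : ∀ (n : ℕ) (ε : ℝ), ∃ (levels : ℕ) (K : ℝ) (T : ℕ), n₀ ≤ n → 0 < ε → ε < 1 →
      1 ≤ levels ∧ levels ≤ n ∧ 4 ≤ K ∧
      4 / (levels * Real.log K) *
          (levels * Real.log (4 * Real.log n) + 3 * Real.log n / (harmonic levels : ℝ)) +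
        8 * K * Real.log (4 / ε) * (levels : ℝ) ^ 2 ≤ T ∧
      ((3 * levels * T + 1 : ℕ) : ℝ) ≤ 11000000 * (Real.log n / Real.log (Real.log n) ^ 2 +
        Real.log n * Real.log (1 / ε) / Real.log (Real.log n) ^ 3) := by
    intro n ε
    by_cases h : n₀ ≤ n ∧ 0 < ε ∧ ε < 1
    · obtain ⟨m, K, T, h'⟩ := exists_parameters (hn₀ n h.1) h.2.1 h.2.2
      exact ⟨m, K, T, fun _ _ _ => h'⟩
    -- Junk values outside the admissible range make the parameters total functions of `n` and `ε`.
    · exact ⟨0, 0, 0, fun h1 h2 h3 => absurd ⟨h1, h2, h3⟩ h⟩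
  choose m K T h using hpar
  refine ⟨1, 11000000, n₀,
    fun n ε => gossip (survival n (m n ε)) (coverDecision (m n ε) (K n ε) (ε / 4) (T n ε)),
    fun n ε => 3 * m n ε * T n ε + 1, le_rfl, by norm_num, fun n hn ε hε hε1 => ?_⟩
  obtain ⟨h1, h2, h3, h4, h5⟩ := h n ε hn hε hε1
  have hlog : 1 ≤ Real.log n := by
    by_contra hlt
    have := Real.log_nonpos (Real.log_natCast_nonneg n) (not_le.1 hlt).le
    linarith [hn₀ n hn]
  have hn2 : 2 ≤ n := by
    by_contra hlt
    have hle : (n : ℝ) ≤ 1 := by exact_mod_cast (by omega : n ≤ 1)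
    linarith [Real.log_nonpos (Nat.cast_nonneg n) hle]
  exact ⟨h5, fun V _ hV G P w => seedMeasure_failure_le hn2 h1 h2 h3 hε hε1
    (epochs_suffice h1 (by linarith) hlog h4) hV P w⟩
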